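/- Let $n\ge 1$, let $a_0\in\mathcal S(\mathbb R^n)$ be complex-valued, and let $V,V_1\in C^\infty(\mathbb R^n;\mathbb R)$ be sub-quadratic, i.e. $\partial^\alpha V,\partial^\alpha V_1\in L^\infty(\mathbb R^n)$ for every multi-index $\alpha\in\mathbb N^n$ with $|\alpha|\ge 2$. Assume that $V_1\not\equiv 0$ on $\operatorname{supp} a_0$. For families of positive numbers indexed by $h\in(0,1]$, write $\alpha^h\ll\beta^h$ if $\alpha^h/\beta^h\to 0$ as $h\to 0$. Let $(\delta^h)_{0<h\le 1}$ be positive numbers with $h^{2/3}\ll\delta^h\ll 1$. For every $h\in(0,1]$ let $u^h,v^h\in C([0,\infty);L^2(\mathbb R^n))$ be solutions (in the sense of distributions) of the initial value problems $$ih\,\partial_t u^h+\frac{h^2}{2}\Delta u^h=V(x)u^h,\qquad u^h|_{t=0}=a_0,$$ $$ih\,\partial_t v^h+\frac{h^2}{2}\Delta v^h=\bigl(V(x)+\delta^h V_1(x)\bigr)v^h,\qquad v^h|_{t=0}=a_0.$$ Then there are times $t^h>0$, $h\in(0,1]$, with $t^h\ll h^{1/3}$, such that $\|u^h-v^h\|_{L^\infty([0,t^h];L^2(\mathbb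 R^n))}\gtrsim 1$; that is, there are $c>0$ and $h_0\in(0,1]$ such that $$\|u^h-v^h\|_{L^\infty([0,t^h];L^2(\mathbb R^n))}\ge c\qquad\text{for all } 0<h\le h_0 .$$ -/

import Mathlib

open Set Filter Topology MeasureTheory
open scoped ENNReal ContDiff SchwartzMap

noncomputable section

/-- A smooth sub-quadratic potential on `ℝⁿ`: a real-valued smooth function all of whose
derivatives of order at least two are bounded. -/
def IsSubquadraticPotential {n : ℕ} (V : EuclideanSpace ℝ (Fin n) → ℝ) : Prop :=
  ContDiff ℝ ∞ V ∧
    ∀ k : ℕ, 2 ≤ k → ∃ C : ℝ, ∀ x, ‖iteratedFDeriv ℝ k V x‖ ≤ C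

/-- `α ≪ β` for families of positive real numbers indexed by `h ∈ (0, 1]`, as `h → 0⁺`. -/
def MuchSmaller (α β : ℝ → ℝ) : Prop :=
  Tendsto (fun h : ℝ => α h / β h) (𝓝[>] 0) (𝓝 0)

/-- `u ∈ C([0, ∞); L²(ℝⁿ))` solves, in the sense of distributions in space, the initial
value problem `i h ∂ₜ u + (h² / 2) Δ u = V u`, `u(0) = a₀`: for every test function `φ` and
every time `t ≥ 0` (one-sided derivative at `t = 0`),
`d/dt (i h ∫ u(t) φ) = ∫ u(t) (-(h² / 2) Δ φ + V φ)`. -/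
structure IsSchrodingerSolution {n : ℕ} (h : ℝ) (V : EuclideanSpace ℝ (Fin n) → ℝ)
    (a₀ : 𝓢(EuclideanSpace ℝ (Fin n), ℂ))
    (u : ℝ → Lp ℂ 2 (volume : Measure (EuclideanSpace ℝ (Fin n)))) : Prop where
  continuousOn : ContinuousOn u (Ici 0)
  initial : u 0 = a₀.toLp 2 volume
  equation : ∀ φ : EuclideanSpace ℝ (Fin n) → ℂ, ContDiff ℝ ∞ φ → HasCompactSupport φ →
    ∀ t ∈ Ici (0 : ℝ),
      HasDerivWithinAt (fun s : ℝ => Complex.I * (h : ℂ) * ∫ x, u s x * φ x)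
        (∫ x, u t x * (-((h : ℂ) ^ 2 / 2) * Laplacian.laplacian φ x + (V x : ℂ) * φ x))
        (Ici 0) t

/-- The norm of `L^∞([0, T]; L²(ℝⁿ))`, as an extended non-negative real number. -/
def normLinftyL2 {n : ℕ} (T : ℝ)
    (w : ℝ → Lp ℂ 2 (volume : Measure (EuclideanSpace ℝ (Fin n)))) : ℝ≥0∞ :=
  eLpNorm w ∞ (volume.restrict (Icc 0 T))

end

set_option linter.unusedSectionVars false

/-! Over times short compared with `h ^ (1 / 3)` the kinetic term is negligible in a weak sense, and
the potential only rotates the phase: `u ≈ a₀ exp (-i t V / h)` and `v ≈ a₀ exp (-i t (V + δ V₁) /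
h)`. At `t = κ h / δ` the two phases differ by the fixed function `κ V₁`, and `h ^ (2 / 3) ≪ δ` says
exactly that this time is `≪ h ^ (1 / 3)`. It remains to detect the difference with a test function.

No WKB ansatz is constructed. A solution with potential `W` is paired with the moving test function
`χ exp (i t W / h)`. The rotation cancels the potential term (`transport_cancellation`), so the
derivative of the pairing is `(i h / 2) ∫ u Δ(χ exp (i t W / h))`, of size `h (1 + t / h) ^ 2 ‖u‖`.
Integration in time gives `exists_pairing_modulated_le` with error `h t + 2 t ^ 2 + t ^ 3 / h`,
which vanishes by `tendsto_time_error`. For `v` the profile is `χ exp (-i κ V₁)`, so that at the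
final time both solutions meet the same test function. The pairings then differ nearly by `∫ a₀ χ (1
- exp (-i κ V₁))`, made nonzero in `exists_separating_profile`, and Cauchy-Schwarz turns this into a
lower bound in `L²`.

This needs a bound on `‖u t‖` uniform in `h`, although the solutions are merely weak and mass
conservation is not assumed. It is supplied by `exists_sup_norm_bound`. The solution is cut off at
radius `R` and mollified at scale `η` with `R η = h`. Every commutator with the Schrödinger operator
is then `O(h)`: the Laplacian costs `h ^ 2 / (R η)`, and a potential with gradient of linear growth
costs `R η`. After division by `h` the regularised mass grows at a rate bounded by the mass,
uniformly in `h` and `R`. Removing the regularisation by Fatou and absorbing the growth over a short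
time gives the bound. -/

/-- The directional derivative of `f` in the direction `v`. -/
noncomputable def dirDeriv {E F : Type*} [NormedAddCommGroup E] [NormedSpace ℝ E]
    [NormedAddCommGroup F] [NormedSpace ℝ F] (v : E) (f : E → F) : E → F :=
  fun x => fderiv ℝ f x v

/-! ### Calculus of directional derivatives of smooth functions -/

section DirDeriv

variable {E F : Type*} [NormedAddCommGroup E] [NormedSpace ℝ E]
  [NormedAddCommGroup F] [NormedSpace ℝ F]

theorem ContDiff.dirDeriv {f : E → F} (hf : ContDiff ℝ ∞ f) (v : E) :
    ContDiff ℝ ∞ (dirDeriv v f) :=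
  (hf.fderiv_right (m := ∞) (by simp)).clm_apply contDiff_const

theorem HasCompactSupport.dirDeriv {f : E → F} (hf : HasCompactSupport f) (v : E) :
    HasCompactSupport (dirDeriv v f) :=
  hf.fderiv_apply ℝ v

theorem tsupport_dirDeriv_subset (f : E → F) (v : E) :
    tsupport (dirDeriv v f) ⊆ tsupport f :=
  tsupport_fderiv_apply_subset ℝ v

theorem ContDiff.differentiable_infty {f : E → F} (hf : ContDiff ℝ ∞ f) :
    Differentiable ℝ f := hf.differentiable (by simp)

theorem dirDeriv_mul {A : Type*} [NormedCommRing A] [NormedAlgebra ℝ A] {f g : E → A}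
    (hf : ContDiff ℝ ∞ f) (hg : ContDiff ℝ ∞ g) (v : E) :
    dirDeriv v (fun x => f x * g x) = fun x => f x * dirDeriv v g x + dirDeriv v f x * g x := by
  funext x
  unfold dirDeriv
  rw [fderiv_fun_mul (hf.differentiable_infty x) (hg.differentiable_infty x)]
  simp [mul_comm]

theorem dirDeriv_add {f g : E → F} (hf : ContDiff ℝ ∞ f) (hg : ContDiff ℝ ∞ g) (v : E) :
    dirDeriv v (fun x => f x + g x) = fun x => dirDeriv v f x + dirDeriv v g x := by
  funext x
  unfold dirDeriv
  rw [fderiv_fun_add (hf.differentiable_infty x) (hg.differentiable_infty x)]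
  simp

theorem dirDeriv_const_mul {A : Type*} [NormedCommRing A] [NormedAlgebra ℝ A] {f : E → A}
    (hf : ContDiff ℝ ∞ f) (c : A) (v : E) :
    dirDeriv v (fun x => c * f x) = fun x => c * dirDeriv v f x := by
  funext x
  unfold dirDeriv
  rw [fderiv_const_mul (hf.differentiable_infty x)]
  simp

theorem dirDeriv_dirDeriv_mul {A : Type*} [NormedCommRing A] [NormedAlgebra ℝ A] {f g : E → A}
    (hf : ContDiff ℝ ∞ f) (hg : ContDiff ℝ ∞ g) (v : E) :
    dirDeriv v (dirDeriv v (fun x => f x * g x)) = fun x =>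
      f x * dirDeriv v (dirDeriv v g) x + 2 * (dirDeriv v f x * dirDeriv v g x)
        + dirDeriv v (dirDeriv v f) x * g x := by
  rw [dirDeriv_mul hf hg, dirDeriv_add (hf.mul (hg.dirDeriv v)) ((hf.dirDeriv v).mul hg),
    dirDeriv_mul hf (hg.dirDeriv v), dirDeriv_mul (hf.dirDeriv v) hg]
  funext x
  ring

theorem dirDeriv_comp_smul {f : E → F} (hf : ContDiff ℝ ∞ f) (a : ℝ) (v : E) :
    dirDeriv v (fun x => f (a • x)) = fun x => a • dirDeriv v f (a • x) := by
  funext x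
  unfold dirDeriv
  have h : HasFDerivAt (fun x : E => f (a • x))
      ((fderiv ℝ f (a • x)).comp (a • ContinuousLinearMap.id ℝ E)) x :=
    (hf.differentiable_infty (a • x)).hasFDerivAt.comp x ((hasFDerivAt_id x).const_smul a)
  rw [h.fderiv]
  simp

theorem dirDeriv_comp_const_sub {f : E → F} (hf : ContDiff ℝ ∞ f) (a v : E) :
    dirDeriv v (fun x => f (a - x)) = fun x => - dirDeriv v f (a - x) := by
  funext x
  unfold dirDeriv
  have h : HasFDerivAt (fun x : E => f (a - x))
      ((fderiv ℝ f (a - x)).comp (-ContinuousLinearMap.id ℝ E)) x :=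
    (hf.differentiable_infty (a - x)).hasFDerivAt.comp x ((hasFDerivAt_id x).const_sub a)
  rw [h.fderiv]
  simp

theorem dirDeriv_neg (f : E → F) (v : E) :
    dirDeriv v (fun x => - f x) = fun x => - dirDeriv v f x := by
  funext x
  unfold dirDeriv
  rw [fderiv_fun_neg]
  simp

theorem dirDeriv_dirDeriv_comp_const_sub {f : E → F} (hf : ContDiff ℝ ∞ f) (a v : E) :
    dirDeriv v (dirDeriv v (fun x => f (a - x))) = fun x => dirDeriv v (dirDeriv v f) (a - x) := by
  rw [dirDeriv_comp_const_sub hf, dirDeriv_neg, dirDeriv_comp_const_sub (hf.dirDeriv v)]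
  simp

theorem dirDeriv_dirDeriv_even {f : E → F} (hf : ContDiff ℝ ∞ f) (he : ∀ x, f (-x) = f x)
    (v x : E) : dirDeriv v (dirDeriv v f) (-x) = dirDeriv v (dirDeriv v f) x := by
  have h := dirDeriv_dirDeriv_comp_const_sub hf 0 v
  simp only [zero_sub, he] at h
  exact (congrFun h x).symm

theorem dirDeriv_ofReal {f : E → ℝ} (hf : ContDiff ℝ ∞ f) (v : E) :
    dirDeriv v (fun x => (f x : ℂ)) = fun x => ((dirDeriv v f x : ℝ) : ℂ) := by
  funext x
  unfold dirDeriv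
  have h : HasFDerivAt (fun x : E => (f x : ℂ)) (Complex.ofRealCLM.comp (fderiv ℝ f x)) x :=
    Complex.ofRealCLM.hasFDerivAt.comp x (hf.differentiable_infty x).hasFDerivAt
  rw [h.fderiv]
  simp

theorem ContDiff.ofReal_infty {f : E → ℝ} (hf : ContDiff ℝ ∞ f) :
    ContDiff ℝ ∞ (fun x => (f x : ℂ)) := Complex.ofRealCLM.contDiff.comp hf

theorem dirDeriv_cexp {f : E → ℂ} (hf : ContDiff ℝ ∞ f) (v : E) :
    dirDeriv v (fun x => Complex.exp (f x)) = fun x => Complex.exp (f x) * dirDeriv v f x := by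
  funext x
  unfold dirDeriv
  rw [((hf.differentiable_infty x).hasFDerivAt.cexp).fderiv]
  simp

end DirDeriv

theorem laplacian_eq_sum_dirDeriv {n : ℕ} {F : Type*} [NormedAddCommGroup F] [NormedSpace ℝ F]
    {f : EuclideanSpace ℝ (Fin n) → F} (hf : ContDiff ℝ ∞ f) (x : EuclideanSpace ℝ (Fin n)) :
    Laplacian.laplacian f x = ∑ i, dirDeriv (EuclideanSpace.basisFun (Fin n) ℝ i)
      (dirDeriv (EuclideanSpace.basisFun (Fin n) ℝ i) f) x := by
  rw [InnerProductSpace.laplacian_eq_iteratedFDeriv_orthonormalBasis f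
    (EuclideanSpace.basisFun (Fin n) ℝ)]
  refine Finset.sum_congr rfl fun i _ => ?_
  rw [iteratedFDeriv_two_apply]
  have h : DifferentiableAt ℝ (fderiv ℝ f) x :=
    (hf.fderiv_right (m := ∞) (by simp)).differentiable_infty x
  unfold dirDeriv
  rw [(h.hasFDerivAt.clm_apply (hasFDerivAt_const _ x)).fderiv]
  simp

/-! ### Integral operators with continuous compactly supported kernels on `L²` -/

/-- The action of a real kernel on a function, `x ↦ ∫ f(y) k(x, y) dy`. -/
noncomputable def kernelOp {E : Type*} [MeasureSpace E] (k : E → E → ℝ) (f : E → ℂ) (x : E) : ℂ :=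
  ∫ y, f y * (k x y : ℂ)

section KernelOp

variable {E : Type*} [NormedAddCommGroup E] [NormedSpace ℝ E] [FiniteDimensional ℝ E]
  [MeasureSpace E] [BorelSpace E] [(volume : Measure E).IsAddHaarMeasure]

theorem integral_mul_eq_inner (f : Lp ℂ 2 (volume : Measure E)) {φ : E → ℂ}
    (hφ : MemLp φ 2 volume) :
    ∫ x, f x * φ x = inner ℂ hφ.star.toLp f := by
  rw [L2.inner_def]
  refine integral_congr_ae ?_
  filter_upwards [hφ.star.coeFn_toLp] with x hx
  rw [hx]
  simp [RCLike.inner_apply]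

theorem norm_integral_mul_le (f : Lp ℂ 2 (volume : Measure E)) {φ : E → ℂ}
    (hφ : MemLp φ 2 volume) :
    ‖∫ x, f x * φ x‖ ≤ ‖hφ.toLp‖ * ‖f‖ := by
  rw [integral_mul_eq_inner f hφ]
  refine (norm_inner_le_norm _ _).trans (le_of_eq ?_)
  congr 1
  refine le_antisymm (Lp.norm_le_norm_of_ae_le ?_) (Lp.norm_le_norm_of_ae_le ?_) <;>
  · filter_upwards [hφ.star.coeFn_toLp, hφ.coeFn_toLp] with x h1 h2
    simp [h1, h2]

theorem integrable_mul_of_memLp_two (f : Lp ℂ 2 (volume : Measure E)) {φ : E → ℂ}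
    (hφ : MemLp φ 2 volume) : Integrable (fun x => f x * φ x) := by
  have := MemLp.integrable_mul (Lp.memLp f) hφ
  exact this

variable {k : E → E → ℝ}

theorem continuous_kernel_right (hk : Continuous (Function.uncurry k)) (x : E) :
    Continuous (k x) := hk.comp (Continuous.prodMk_right x)

theorem hasCompactSupport_kernel_right (hc : HasCompactSupport (Function.uncurry k)) (x : E) :
    HasCompactSupport (k x) := by
  refine HasCompactSupport.of_support_subset_isCompact (hc.isCompact.image continuous_snd) ?_
  intro y hy
  exact ⟨(x, y), subset_tsupport _ hy, rfl⟩

theorem memLp_kernel_right (hk : Continuous (Function.uncurry k))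
    (hc : HasCompactSupport (Function.uncurry k)) (x : E) :
    MemLp (fun y => (k x y : ℂ)) 2 volume := by
  refine Continuous.memLp_of_hasCompactSupport
    (Complex.continuous_ofReal.comp (continuous_kernel_right hk x)) ?_
  exact (hasCompactSupport_kernel_right hc x).comp_left (g := ((↑) : ℝ → ℂ)) (by simp)

/-- Cauchy-Schwarz against the indicator of the second projection of the support. The bound depends
on `f` only through its norm, so it serves as a dominating function along a whole curve in `L²`. -/
theorem exists_bound_kernelOp (hk : Continuous (Function.uncurry k))
    (hc : HasCompactSupport (Function.uncurry k)) :
    ∃ (S : Set E) (D : ℝ), IsCompact S ∧ 0 ≤ D ∧ ∀ (f : Lp ℂ 2 (volume : Measure E)) (x : E),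
      ‖kernelOp k f x‖ ≤ S.indicator (fun _ => D) x * ‖f‖ := by
  obtain ⟨C, hC⟩ := hc.exists_bound_of_continuous hk
  have hS₂ : IsCompact (Prod.snd '' tsupport (Function.uncurry k)) :=
    hc.isCompact.image continuous_snd
  have hg := memLp_indicator_const (μ := (volume : Measure E)) 2 hS₂.measurableSet (C : ℂ)
    (Or.inr hS₂.measure_lt_top.ne)
  refine ⟨Prod.fst '' tsupport (Function.uncurry k), ‖hg.toLp‖, hc.isCompact.image continuous_fst,
    norm_nonneg _, fun f x => ?_⟩
  by_cases hx : x ∈ Prod.fst '' tsupport (Function.uncurry k)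
  · rw [indicator_of_mem hx]
    refine (norm_integral_mul_le f (memLp_kernel_right hk hc x)).trans ?_
    gcongr
    refine Lp.norm_le_norm_of_ae_le ?_
    filter_upwards [hg.coeFn_toLp, (memLp_kernel_right hk hc x).coeFn_toLp] with y h1 h2
    rw [h1, h2]
    by_cases hy : y ∈ Prod.snd '' tsupport (Function.uncurry k)
    · rw [indicator_of_mem hy]
      simpa using (hC (x, y)).trans (le_abs_self C)
    · rw [indicator_of_notMem hy]
      have : k x y = 0 := by
        by_contra h
        exact hy ⟨(x, y), subset_tsupport _ h, rfl⟩
      simp [this]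
  · rw [indicator_of_notMem hx]
    have : ∀ y, k x y = 0 := by
      intro y
      by_contra h
      exact hx ⟨(x, y), subset_tsupport _ h, rfl⟩
    simp [kernelOp, this]

theorem aestronglyMeasurable_kernelOp (hk : Continuous (Function.uncurry k))
    (f : Lp ℂ 2 (volume : Measure E)) :
    AEStronglyMeasurable (kernelOp k f) volume := by
  refine AEStronglyMeasurable.integral_prod_right' (f := fun z : E × E => f z.2 * (k z.1 z.2 : ℂ)) ?_
  refine AEStronglyMeasurable.mul ?_ ?_
  · exact (Lp.aestronglyMeasurable f).comp_snd
  · exact (Complex.continuous_ofReal.comp hk).aestronglyMeasurable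

theorem integrable_normSq_kernelOp (hk : Continuous (Function.uncurry k))
    (hc : HasCompactSupport (Function.uncurry k)) (f : Lp ℂ 2 (volume : Measure E)) :
    Integrable (fun x => ‖kernelOp k f x‖ ^ 2) := by
  obtain ⟨S, D, hS, hD, hb⟩ := exists_bound_kernelOp hk hc
  have hi : Integrable (S.indicator (fun _ => (D * ‖f‖) ^ 2)) (volume : Measure E) :=
    (integrable_indicator_iff hS.measurableSet).2 (integrableOn_const hS.measure_lt_top.ne)
  refine hi.mono' ((aestronglyMeasurable_kernelOp hk f).norm.pow 2) (ae_of_all _ fun x => ?_)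
  have := hb f x
  rw [norm_pow, norm_norm]
  by_cases hx : x ∈ S
  · simp only [indicator_of_mem hx] at this ⊢
    gcongr
  · simp only [indicator_of_notMem hx, zero_mul, norm_le_zero_iff] at this ⊢
    simp [this]

/-- Differentiation under the integral: the curve `u` is only differentiable after pairing, that is,
for each fixed `x`, and the uniform kernel bounds dominate the derivative in `x`. -/
theorem hasDerivAt_integral_normSq_kernelOp {p l : E → E → ℝ}
    (hp : Continuous (Function.uncurry p)) (hpc : HasCompactSupport (Function.uncurry p))
    (hl : Continuous (Function.uncurry l)) (hlc : HasCompactSupport (Function.uncurry l))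
    {u : ℝ → Lp ℂ 2 (volume : Measure E)} (hu : ContinuousOn u (Ici 0)) {c : ℂ}
    (hd : ∀ x, ∀ s, 0 < s → HasDerivAt (fun s => kernelOp p (u s) x) (c * kernelOp l (u s) x) s)
    {t : ℝ} (ht : 0 < t) :
    HasDerivAt (fun s => ∫ x, ‖kernelOp p (u s) x‖ ^ 2)
      (∫ x, 2 * inner ℝ (kernelOp p (u t) x) (c * kernelOp l (u t) x)) t := by
  obtain ⟨S, D, hS, hD, hb⟩ := exists_bound_kernelOp hp hpc
  obtain ⟨S', D', hS', hD', hb'⟩ := exists_bound_kernelOp hl hlc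
  -- A compact neighbourhood of `t` that stays away from time `0`, where only a one-sided derivative
  -- exists.
  obtain ⟨M, hM⟩ := (isCompact_Icc (a := t / 2) (b := 2 * t)).exists_bound_of_continuousOn
    (hu.mono fun s hs => le_trans (by positivity) hs.1)
  have hI : Icc (t / 2) (2 * t) ∈ 𝓝 t := Icc_mem_nhds (by linarith) (by linarith)
  have hi : Integrable (S.indicator (fun _ => 2 * ((D * M) * (‖c‖ * (D' * M)))))
      (volume : Measure E) :=
    (integrable_indicator_iff hS.measurableSet).2 (integrableOn_const hS.measure_lt_top.ne)
  refine (hasDerivAt_integral_of_dominated_loc_of_deriv_le (𝕜 := ℝ) hI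
    (F := fun s x => ‖kernelOp p (u s) x‖ ^ 2)
    (F' := fun s x => 2 * inner ℝ (kernelOp p (u s) x) (c * kernelOp l (u s) x))
    (Eventually.of_forall fun s => ((aestronglyMeasurable_kernelOp hp (u s)).norm.pow 2))
    (integrable_normSq_kernelOp hp hpc (u t)) ?_ (ae_of_all _ fun x s hs => ?_) hi
    (ae_of_all _ fun x s hs => ?_)).2
  · exact ((aestronglyMeasurable_kernelOp hp (u t)).inner
      ((aestronglyMeasurable_kernelOp hl (u t)).const_mul c)).const_mul 2
  · have h1 := hb (u s) x
    have h2 := hb' (u s) x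
    have h3 := hM s hs
    have hM0 : 0 ≤ M := (norm_nonneg _).trans h3
    have h4 : ‖kernelOp l (u s) x‖ ≤ D' * M := by
      refine h2.trans (mul_le_mul ?_ h3 (norm_nonneg _) hD')
      exact indicator_le_self' (fun _ _ => hD') x
    rw [norm_mul]
    by_cases hx : x ∈ S
    · rw [indicator_of_mem hx] at h1 ⊢
      have h5 : ‖kernelOp p (u s) x‖ ≤ D * M := h1.trans (mul_le_mul_of_nonneg_left h3 hD)
      have := norm_inner_le_norm (𝕜 := ℝ) (kernelOp p (u s) x) (c * kernelOp l (u s) x)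
      rw [norm_mul] at this
      calc ‖(2 : ℝ)‖ * ‖inner ℝ (kernelOp p (u s) x) (c * kernelOp l (u s) x)‖
          ≤ 2 * (‖kernelOp p (u s) x‖ * (‖c‖ * ‖kernelOp l (u s) x‖)) := by
            rw [Real.norm_ofNat]; gcongr
        _ ≤ _ := by gcongr
    · rw [indicator_of_notMem hx] at h1 ⊢
      simp only [zero_mul, norm_le_zero_iff] at h1
      simp [h1]
  · exact (hd x s (lt_of_lt_of_le (by positivity) hs.1)).norm_sq

end KernelOp

/-! ### Composition and symmetry of kernels, and Young's inequality for averages -/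

section KernelFubini

variable {E : Type*} [NormedAddCommGroup E] [NormedSpace ℝ E] [FiniteDimensional ℝ E]
  [MeasureSpace E] [BorelSpace E] [(volume : Measure E).IsAddHaarMeasure]

theorem integrable_kernelOp {k : E → E → ℝ} (hk : Continuous (Function.uncurry k))
    (hc : HasCompactSupport (Function.uncurry k)) (f : Lp ℂ 2 (volume : Measure E)) :
    Integrable (kernelOp k f) := by
  obtain ⟨S, D, hS, hD, hb⟩ := exists_bound_kernelOp hk hc
  have hi : Integrable (S.indicator (fun _ => D)) (volume : Measure E) :=
    (integrable_indicator_iff hS.measurableSet).2 (integrableOn_const hS.measure_lt_top.ne)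
  exact (hi.mul_const ‖f‖).mono' (aestronglyMeasurable_kernelOp hk f) (ae_of_all _ (hb f))

/-- An `L²` function need not be integrable, but the kernel sees it only on a compact set, where it
is. This licenses the uses of Fubini below. -/
theorem integrable_mul_kernel {k : E → E → ℝ} (hk : Continuous (Function.uncurry k))
    (hc : HasCompactSupport (Function.uncurry k)) {a : E → ℂ} (ha : Integrable a)
    (f : Lp ℂ 2 (volume : Measure E)) :
    Integrable (fun z : E × E => a z.1 * (f z.2 * (k z.1 z.2 : ℂ))) (volume.prod volume) := by
  obtain ⟨C, hC⟩ := hc.exists_bound_of_continuous hk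
  have hS₂ : IsCompact (Prod.snd '' tsupport (Function.uncurry k)) :=
    hc.isCompact.image continuous_snd
  set T := Prod.snd '' tsupport (Function.uncurry k)
  have hfT : Integrable (T.indicator f) volume := by
    rw [integrable_indicator_iff hS₂.measurableSet]
    exact ((Lp.memLp f).locallyIntegrable (by norm_num)).integrableOn_isCompact hS₂
  have h1 := (ha.mul_prod hfT).mul_bdd (c := C) (g := fun z : E × E => (k z.1 z.2 : ℂ))
    (Complex.continuous_ofReal.comp hk).aestronglyMeasurable
    (ae_of_all _ fun z => by simpa [Function.uncurry] using hC z)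
  refine h1.congr (ae_of_all _ fun z => ?_)
  by_cases hz : z.2 ∈ T
  · simp [indicator_of_mem hz, mul_assoc]
  · have : k z.1 z.2 = 0 := by
      by_contra h
      exact hz ⟨z, subset_tsupport _ h, rfl⟩
    simp [this]

theorem integral_kernelOp_mul_kernelOp {k₁ k₂ : E → E → ℝ}
    (hk₁ : Continuous (Function.uncurry k₁)) (hc₁ : HasCompactSupport (Function.uncurry k₁))
    (hk₂ : Continuous (Function.uncurry k₂)) (hc₂ : HasCompactSupport (Function.uncurry k₂))
    (f g : Lp ℂ 2 (volume : Measure E)) :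
    ∫ x, kernelOp k₁ f x * kernelOp k₂ g x =
      ∫ z, ∫ y, f y * g z * ((∫ x, k₁ x y * k₂ x z : ℝ) : ℂ) := by
  have h1 : ∫ x, kernelOp k₁ f x * kernelOp k₂ g x =
      ∫ x, ∫ z, kernelOp k₁ f x * (g z * (k₂ x z : ℂ)) := by
    refine integral_congr_ae (ae_of_all _ fun x => ?_)
    simp only [kernelOp]
    rw [← integral_const_mul]
  rw [h1, integral_integral_swap (integrable_mul_kernel hk₂ hc₂ (integrable_kernelOp hk₁ hc₁ f) g)]
  refine integral_congr_ae (ae_of_all _ fun z => ?_)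
  simp only
  have hz : Continuous fun x => (k₂ x z : ℂ) :=
    Complex.continuous_ofReal.comp (hk₂.comp (Continuous.prodMk_left z))
  have hzc : HasCompactSupport fun x => (k₂ x z : ℂ) := by
    refine HasCompactSupport.of_support_subset_isCompact (hc₂.isCompact.image continuous_fst) ?_
    intro x hx
    have hx' : k₂ x z ≠ 0 := by simpa using hx
    exact ⟨(x, z), subset_tsupport _ hx', rfl⟩
  have ha : Integrable fun x => g z * (k₂ x z : ℂ) :=
    (hz.integrable_of_hasCompactSupport hzc).const_mul _
  have h2 : ∫ x, kernelOp k₁ f x * (g z * (k₂ x z : ℂ)) =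
      ∫ x, ∫ y, (g z * (k₂ x z : ℂ)) * (f y * (k₁ x y : ℂ)) := by
    refine integral_congr_ae (ae_of_all _ fun x => ?_)
    simp only [kernelOp]
    rw [integral_const_mul, mul_comm]
  rw [h2, integral_integral_swap (integrable_mul_kernel hk₁ hc₁ ha f)]
  refine integral_congr_ae (ae_of_all _ fun y => ?_)
  simp only
  rw [← integral_complex_ofReal, ← integral_const_mul]
  refine integral_congr_ae (ae_of_all _ fun x => ?_)
  push_cast
  ring

theorem conj_kernelOp (k : E → E → ℝ) (f : Lp ℂ 2 (volume : Measure E)) (x : E) :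
    (starRingEnd ℂ) (kernelOp k f x) = kernelOp k ((Lp.memLp f).star.toLp) x := by
  unfold kernelOp
  rw [← integral_conj]
  refine integral_congr_ae ?_
  filter_upwards [(Lp.memLp f).star.coeFn_toLp] with y hy
  rw [hy]
  simp

/-- The hypothesis `hpm` says that the composed kernel of the transpose of `p` with `m` is
symmetric. Being real, it defines a self-adjoint operator, whose quadratic form is real. -/
theorem integral_im_kernelOp_eq_zero {p m : E → E → ℝ}
    (hp : Continuous (Function.uncurry p)) (hpc : HasCompactSupport (Function.uncurry p))
    (hm : Continuous (Function.uncurry m)) (hmc : HasCompactSupport (Function.uncurry m))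
    (hpm : ∀ y z, ∫ x, p x y * m x z = ∫ x, m x y * p x z)
    (f : Lp ℂ 2 (volume : Measure E)) :
    (∫ x, (starRingEnd ℂ) (kernelOp p f x) * kernelOp m f x).im = 0 := by
  rw [← Complex.conj_eq_iff_im, ← integral_conj]
  have h1 : ∀ x, (starRingEnd ℂ) ((starRingEnd ℂ) (kernelOp p f x) * kernelOp m f x) =
      kernelOp m ((Lp.memLp f).star.toLp) x * kernelOp p f x := by
    intro x
    rw [map_mul, Complex.conj_conj, conj_kernelOp, mul_comm]
  simp_rw [h1, conj_kernelOp]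
  rw [integral_kernelOp_mul_kernelOp hm hmc hp hpc, integral_kernelOp_mul_kernelOp hp hpc hm hmc]
  simp_rw [hpm]

/-- The weighted average `x ↦ ∫ |f(y)| q(x - y) dy`. -/
noncomputable def absAverage (q : E → ℝ) (f : E → ℂ) (x : E) : ℝ := ∫ y, ‖f y‖ * q (x - y)

theorem integral_norm_sq_Lp (f : Lp ℂ 2 (volume : Measure E)) : ∫ x, ‖f x‖ ^ 2 = ‖f‖ ^ 2 := by
  have h := real_inner_self_eq_norm_sq f
  rw [L2.inner_def] at h
  rw [← h]
  refine integral_congr_ae (ae_of_all _ fun x => ?_)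
  exact (real_inner_self_eq_norm_sq (f x)).symm

theorem memLp_comp_const_sub {q : E → ℝ} (hq : Continuous q) (hqc : HasCompactSupport q) (x : E)
    (p : ℝ≥0∞) : MemLp (fun y => q (x - y)) p (volume : Measure E) := by
  refine Continuous.memLp_of_hasCompactSupport (hq.comp (continuous_const.sub continuous_id)) ?_
  exact hqc.comp_homeomorph (Homeomorph.subLeft x)

variable {q : E → ℝ} (hq : Continuous q) (hqc : HasCompactSupport q) (hq0 : ∀ x, 0 ≤ q x)

include hq hqc in
theorem integrable_absAverage_integrand (f : Lp ℂ 2 (volume : Measure E)) (x : E) :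
    Integrable fun y => ‖f y‖ * q (x - y) :=
  MemLp.integrable_mul (Lp.memLp f).norm (memLp_comp_const_sub hq hqc x 2)

include hq0 in
theorem absAverage_nonneg (f : E → ℂ) (x : E) : 0 ≤ absAverage q f x :=
  integral_nonneg fun _ => mul_nonneg (norm_nonneg _) (hq0 _)

theorem integrable_norm_sq_Lp (f : Lp ℂ 2 (volume : Measure E)) : Integrable fun x => ‖f x‖ ^ 2 :=
  (memLp_two_iff_integrable_sq_norm (Lp.aestronglyMeasurable f)).1 (Lp.memLp f)

include hq hqc in
theorem integrable_sq_absAverage_integrand (f : Lp ℂ 2 (volume : Measure E)) (x : E) :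
    Integrable fun y => ‖f y‖ ^ 2 * q (x - y) := by
  obtain ⟨C, hC⟩ := hqc.exists_bound_of_continuous hq
  exact (integrable_norm_sq_Lp f).mul_bdd (c := C)
    (hq.comp (continuous_const.sub continuous_id)).aestronglyMeasurable
    (ae_of_all _ fun _ => hC _)

include hq hqc hq0 in
-- Cauchy-Schwarz for the weight `q (x - ·)`, read off from the discriminant of the nonnegative
-- quadratic `s ↦ ∫ (s ‖f y‖ - 1) ^ 2 q (x - y) dy`.
theorem sq_absAverage_le (f : Lp ℂ 2 (volume : Measure E)) (x : E) :
    absAverage q f x ^ 2 ≤ (∫ y, q y) * ∫ y, ‖f y‖ ^ 2 * q (x - y) := by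
  set a := absAverage q f x with ha
  have hQ : ∫ y, q (x - y) = ∫ y, q y := integral_sub_left_eq_self q volume x
  have hi1 := integrable_absAverage_integrand hq hqc f x
  have hi2 := integrable_sq_absAverage_integrand hq hqc f x
  have hi3 : Integrable fun y => q (x - y) :=
    memLp_one_iff_integrable.1 (memLp_comp_const_sub hq hqc x 1)
  set Q := ∫ y, q y with hQd
  set I := ∫ y, ‖f y‖ ^ 2 * q (x - y) with hI
  have key : ∀ s : ℝ, 0 ≤ I * (s * s) + (-2 * a) * s + Q := by
    intro s
    have h0 : 0 ≤ ∫ y, (s * ‖f y‖ - 1) ^ 2 * q (x - y) :=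
      integral_nonneg fun y => mul_nonneg (sq_nonneg _) (hq0 _)
    have h1 : ∫ y, (s * ‖f y‖ - 1) ^ 2 * q (x - y) =
        ∫ y, ((s * s) * (‖f y‖ ^ 2 * q (x - y)) + (-2 * s) * (‖f y‖ * q (x - y)) + q (x - y)) :=
      integral_congr_ae (ae_of_all _ fun y => by ring)
    have h2 := integral_add ((hi2.const_mul (s * s)).add (hi1.const_mul (-2 * s))) hi3
    simp only [Pi.add_apply] at h2
    rw [h1, h2, integral_add (hi2.const_mul _) (hi1.const_mul _), integral_const_mul,
      integral_const_mul, hQ] at h0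
    have : ∫ y, ‖f y‖ * q (x - y) = a := rfl
    rw [this] at h0
    linarith
  have := discrim_le_zero key
  unfold discrim at this
  nlinarith

include hq hqc in
theorem aestronglyMeasurable_absAverage (f : Lp ℂ 2 (volume : Measure E)) :
    AEStronglyMeasurable (absAverage q f) volume := by
  refine AEStronglyMeasurable.integral_prod_right' (f := fun z : E × E => ‖f z.2‖ * q (z.1 - z.2)) ?_
  exact ((Lp.aestronglyMeasurable f).norm.comp_snd).mul
    (hq.comp (continuous_fst.sub continuous_snd)).aestronglyMeasurable

include hq hqc hq0 in
-- Young's inequality for the convolution of `L¹` with `L²`. Only `∫ q` enters, which is what makes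
-- the later bounds independent of the mollification scale.
theorem integrable_and_integral_sq_absAverage_le (f : Lp ℂ 2 (volume : Measure E)) :
    Integrable (fun x => absAverage q f x ^ 2) ∧
      ∫ x, absAverage q f x ^ 2 ≤ (∫ y, q y) ^ 2 * ‖f‖ ^ 2 := by
  have hqi : Integrable q := hq.integrable_of_hasCompactSupport hqc
  have hfi := integrable_norm_sq_Lp f
  have hconv : Integrable (fun x => (∫ y, q y) * ∫ y, ‖f y‖ ^ 2 * q (x - y)) :=
    (hfi.integrable_convolution (ContinuousLinearMap.mul ℝ ℝ) hqi).const_mul _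
  have hint : ∫ x, ∫ y, ‖f y‖ ^ 2 * q (x - y) = ‖f‖ ^ 2 * ∫ y, q y := by
    rw [← integral_norm_sq_Lp f]
    exact integral_convolution (ContinuousLinearMap.mul ℝ ℝ) hfi hqi
  have hsq : Integrable (fun x => absAverage q f x ^ 2) := by
    refine hconv.mono' ((aestronglyMeasurable_absAverage hq hqc f).pow 2) (ae_of_all _ fun x => ?_)
    rw [Real.norm_of_nonneg (sq_nonneg _)]
    exact sq_absAverage_le hq hqc hq0 f x
  refine ⟨hsq, ?_⟩
  calc ∫ x, absAverage q f x ^ 2 ≤ ∫ x, (∫ y, q y) * ∫ y, ‖f y‖ ^ 2 * q (x - y) :=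
        integral_mono hsq hconv fun x => sq_absAverage_le hq hqc hq0 f x
    _ = _ := by rw [integral_const_mul, hint]; ring

end KernelFubini

/-! ### Energy estimate for a regularised solution -/

section EnergyEstimate

variable {E : Type*} [NormedAddCommGroup E] [NormedSpace ℝ E] [FiniteDimensional ℝ E]
  [MeasureSpace E] [BorelSpace E] [(volume : Measure E).IsAddHaarMeasure]

theorem memLp_kernelOp {k : E → E → ℝ} (hk : Continuous (Function.uncurry k))
    (hc : HasCompactSupport (Function.uncurry k)) (f : Lp ℂ 2 (volume : Measure E)) :
    MemLp (kernelOp k f) 2 volume :=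
  (memLp_two_iff_integrable_sq_norm (aestronglyMeasurable_kernelOp hk f)).2
    (integrable_normSq_kernelOp hk hc f)

theorem norm_kernelOp_le_absAverage {k : E → E → ℝ} {q : E → ℝ} (hq : Continuous q)
    (hqc : HasCompactSupport q) {C : ℝ} (hkq : ∀ x y, |k x y| ≤ C * q (x - y))
    (f : Lp ℂ 2 (volume : Measure E)) (x : E) :
    ‖kernelOp k f x‖ ≤ C * absAverage q f x := by
  unfold kernelOp absAverage
  rw [← integral_const_mul]
  refine norm_integral_le_of_norm_le
    ((integrable_absAverage_integrand hq hqc f x).const_mul C) (ae_of_all _ fun y => ?_)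
  rw [norm_mul, Complex.norm_real, Real.norm_eq_abs]
  calc ‖f y‖ * |k x y| ≤ ‖f y‖ * (C * q (x - y)) := by gcongr; exact hkq x y
    _ = _ := by ring

/-- If `l(x, y) = a m(x, y) + W(x) p(x, y) + e(x, y)` where `p` and `m` satisfy a symmetry relation
and `e` is small, then the energy form associated with `p` and `l` is bounded. -/
theorem abs_integral_inner_kernelOp_le {p m e l : E → E → ℝ} {q : E → ℝ} {W : E → ℝ} {a h C : ℝ}
    (hp : Continuous (Function.uncurry p)) (hpc : HasCompactSupport (Function.uncurry p))
    (hm : Continuous (Function.uncurry m)) (hmc : HasCompactSupport (Function.uncurry m))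
    (he : Continuous (Function.uncurry e)) (hec : HasCompactSupport (Function.uncurry e))
    (hpm : ∀ y z, ∫ x, p x y * m x z = ∫ x, m x y * p x z)
    (hl : ∀ x y, l x y = a * m x y + W x * p x y + e x y)
    (hq : Continuous q) (hqc : HasCompactSupport q) (hq0 : ∀ x, 0 ≤ q x)
    (hpq : ∀ x y, |p x y| ≤ q (x - y)) (hC : 0 ≤ C) (hh : 0 < h)
    (heq : ∀ x y, |e x y| ≤ C * h * q (x - y)) (f : Lp ℂ 2 (volume : Measure E)) :
    |∫ x, 2 * inner ℝ (kernelOp p f x) ((Complex.I * h)⁻¹ * kernelOp l f x)| ≤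
      2 * C * (∫ y, q y) ^ 2 * ‖f‖ ^ 2 := by
  have hlop : ∀ x, kernelOp l f x =
      a * kernelOp m f x + W x * kernelOp p f x + kernelOp e f x := by
    intro x
    have i1 := integrable_mul_of_memLp_two f (memLp_kernel_right hm hmc x)
    have i2 := integrable_mul_of_memLp_two f (memLp_kernel_right hp hpc x)
    have i3 := integrable_mul_of_memLp_two f (memLp_kernel_right he hec x)
    have h2 := integral_add ((i1.const_mul (a : ℂ)).add (i2.const_mul (W x : ℂ))) i3
    simp only [Pi.add_apply] at h2
    unfold kernelOp
    rw [← integral_const_mul, ← integral_const_mul,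
      ← integral_add (i1.const_mul _) (i2.const_mul _), ← h2]
    refine integral_congr_ae (ae_of_all _ fun y => ?_)
    simp only [hl]
    push_cast
    ring
  -- The potential term has disappeared: `W` is real, so its contribution `W ‖kernelOp p f x‖ ^ 2`
  -- becomes purely imaginary after division by `i h`.
  have hpt : ∀ x, 2 * inner ℝ (kernelOp p f x) ((Complex.I * h)⁻¹ * kernelOp l f x) =
      (2 * a / h) * ((starRingEnd ℂ) (kernelOp p f x) * kernelOp m f x).im +
        (2 / h) * ((starRingEnd ℂ) (kernelOp p f x) * kernelOp e f x).im := by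
    intro x
    rw [hlop, Complex.inner, mul_inv, Complex.inv_I]
    rw [show ((h : ℂ))⁻¹ = ((h⁻¹ : ℝ) : ℂ) by push_cast; rfl]
    simp only [Complex.mul_re, Complex.mul_im, Complex.add_re, Complex.add_im, Complex.conj_re,
      Complex.conj_im, Complex.neg_re, Complex.neg_im, Complex.I_re, Complex.I_im,
      Complex.ofReal_re, Complex.ofReal_im]
    ring
  have j1 : Integrable fun x => (starRingEnd ℂ) (kernelOp p f x) * kernelOp m f x :=
    MemLp.integrable_mul (memLp_kernelOp hp hpc f).star (memLp_kernelOp hm hmc f)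
  have j2 : Integrable fun x => (starRingEnd ℂ) (kernelOp p f x) * kernelOp e f x :=
    MemLp.integrable_mul (memLp_kernelOp hp hpc f).star (memLp_kernelOp he hec f)
  have k1 : ∫ x, ((starRingEnd ℂ) (kernelOp p f x) * kernelOp m f x).im = 0 := by
    have := integral_im_kernelOp_eq_zero hp hpc hm hmc hpm f
    rw [← this]
    exact integral_im j1
  simp_rw [hpt]
  have j1' : Integrable fun x => ((starRingEnd ℂ) (kernelOp p f x) * kernelOp m f x).im := j1.im
  have j2' : Integrable fun x => ((starRingEnd ℂ) (kernelOp p f x) * kernelOp e f x).im := j2.im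
  rw [integral_add (j1'.const_mul _) (j2'.const_mul _), integral_const_mul, integral_const_mul,
    k1, mul_zero, zero_add]
  -- Only the commutator kernel `e` is left, and its factor `h` pays for the prefactor `2 / h`.
  obtain ⟨hAi, hAle⟩ := integrable_and_integral_sq_absAverage_le hq hqc hq0 f
  have hbound : |∫ x, ((starRingEnd ℂ) (kernelOp p f x) * kernelOp e f x).im| ≤
      ∫ x, C * h * absAverage q f x ^ 2 := by
    rw [← Real.norm_eq_abs]
    refine norm_integral_le_of_norm_le (hAi.const_mul (C * h)) (ae_of_all _ fun x => ?_)
    have a1 := norm_kernelOp_le_absAverage hq hqc (C := 1) (by simpa using hpq) f x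
    have a2 := norm_kernelOp_le_absAverage hq hqc heq f x
    have a3 := absAverage_nonneg hq0 f x
    rw [one_mul] at a1
    calc ‖((starRingEnd ℂ) (kernelOp p f x) * kernelOp e f x).im‖
        ≤ ‖(starRingEnd ℂ) (kernelOp p f x) * kernelOp e f x‖ := Complex.abs_im_le_norm _
      _ = ‖kernelOp p f x‖ * ‖kernelOp e f x‖ := by rw [norm_mul, RCLike.norm_conj]
      _ ≤ absAverage q f x * (C * h * absAverage q f x) := by gcongr
      _ = _ := by ring
  rw [integral_const_mul] at hbound
  rw [abs_mul, abs_of_pos (by positivity : (0 : ℝ) < 2 / h)]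
  calc 2 / h * |∫ x, ((starRingEnd ℂ) (kernelOp p f x) * kernelOp e f x).im|
      ≤ 2 / h * (C * h * ((∫ y, q y) ^ 2 * ‖f‖ ^ 2)) := by
        gcongr
        exact hbound.trans (by gcongr)
    _ = _ := by field_simp

theorem integral_normSq_kernelOp_le {p : E → E → ℝ} {q : E → ℝ}
    (hp : Continuous (Function.uncurry p)) (hpc : HasCompactSupport (Function.uncurry p))
    (hq : Continuous q) (hqc : HasCompactSupport q) (hq0 : ∀ x, 0 ≤ q x)
    (hpq : ∀ x y, |p x y| ≤ q (x - y)) (f : Lp ℂ 2 (volume : Measure E)) :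
    ∫ x, ‖kernelOp p f x‖ ^ 2 ≤ (∫ y, q y) ^ 2 * ‖f‖ ^ 2 := by
  obtain ⟨hAi, hAle⟩ := integrable_and_integral_sq_absAverage_le hq hqc hq0 f
  refine (integral_mono (integrable_normSq_kernelOp hp hpc f) hAi fun x => ?_).trans hAle
  have a1 := norm_kernelOp_le_absAverage hq hqc (C := 1) (by simpa using hpq) f x
  rw [one_mul] at a1
  exact pow_le_pow_left₀ (norm_nonneg _) a1 2

/-- Growth bound for the regularised energy `∫ |∫ p(x, y) u(t, y) dy|² dx` of a weak solution. -/
theorem regularised_energy_le {p m e l : E → E → ℝ} {q : E → ℝ} {W : E → ℝ} {a h C : ℝ}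
    (hp : Continuous (Function.uncurry p)) (hpc : HasCompactSupport (Function.uncurry p))
    (hm : Continuous (Function.uncurry m)) (hmc : HasCompactSupport (Function.uncurry m))
    (he : Continuous (Function.uncurry e)) (hec : HasCompactSupport (Function.uncurry e))
    (hlC : Continuous (Function.uncurry l)) (hlc : HasCompactSupport (Function.uncurry l))
    (hpm : ∀ y z, ∫ x, p x y * m x z = ∫ x, m x y * p x z)
    (hl : ∀ x y, l x y = a * m x y + W x * p x y + e x y)
    (hq : Continuous q) (hqc : HasCompactSupport q) (hq0 : ∀ x, 0 ≤ q x)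
    (hpq : ∀ x y, |p x y| ≤ q (x - y)) (hC : 0 ≤ C) (hh : 0 < h)
    (heq : ∀ x y, |e x y| ≤ C * h * q (x - y))
    {u : ℝ → Lp ℂ 2 (volume : Measure E)} (hu : ContinuousOn u (Ici 0))
    (hd : ∀ x, ∀ s, 0 < s →
      HasDerivAt (fun s => kernelOp p (u s) x) ((Complex.I * h)⁻¹ * kernelOp l (u s) x) s)
    {s T M : ℝ} (hs : 0 < s) (hsT : s ≤ T) (hM : ∀ r ∈ Icc s T, ‖u r‖ ^ 2 ≤ M) :
    ∫ x, ‖kernelOp p (u T) x‖ ^ 2 ≤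
      (∫ y, q y) ^ 2 * ‖u s‖ ^ 2 + 2 * C * (∫ y, q y) ^ 2 * M * (T - s) := by
  have hder : ∀ r ∈ Icc s T, HasDerivAt (fun s => ∫ x, ‖kernelOp p (u s) x‖ ^ 2)
      (∫ x, 2 * inner ℝ (kernelOp p (u r) x) ((Complex.I * h)⁻¹ * kernelOp l (u r) x)) r :=
    fun r hr => hasDerivAt_integral_normSq_kernelOp hp hpc hlC hlc hu hd (hs.trans_le hr.1)
  -- Mean value inequality from a positive time `s`, since the two-sided derivative is available
  -- only there. The limit `s → 0` is taken in `exists_mass_bound`.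
  have key := (convex_Icc s T).image_sub_le_mul_sub_of_deriv_le
    (f := fun s => ∫ x, ‖kernelOp p (u s) x‖ ^ 2) (C := 2 * C * (∫ y, q y) ^ 2 * M)
    (fun r hr => (hder r hr).continuousAt.continuousWithinAt)
    (fun r hr => (hder r (interior_subset hr)).differentiableAt.differentiableWithinAt)
    (fun r hr => by
      rw [(hder r (interior_subset hr)).deriv]
      refine (le_abs_self _).trans ((abs_integral_inner_kernelOp_le hp hpc hm hmc he hec hpm hl hq
        hqc hq0 hpq hC hh heq (u r)).trans ?_)
      gcongr
      exact hM r (interior_subset hr))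
    s ⟨le_rfl, hsT⟩ T ⟨hsT, le_rfl⟩ hsT
  have h0 := integral_normSq_kernelOp_le hp hpc hq hqc hq0 hpq (u s)
  linarith

end EnergyEstimate

/-! ### The cutoff-and-mollify kernel and its commutator with the Schrödinger operator -/

section Mollifier

variable {n : ℕ}

/-- The `i`-th partial derivative. -/
noncomputable def partialDeriv {F : Type*} [NormedAddCommGroup F] [NormedSpace ℝ F] (i : Fin n)
    (f : EuclideanSpace ℝ (Fin n) → F) : EuclideanSpace ℝ (Fin n) → F :=
  dirDeriv (EuclideanSpace.basisFun (Fin n) ℝ i) f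

/-- The kernel of the operator that multiplies by `χ` and then convolves with `ρ`. -/
def cutoffMollifier (χ ρ : EuclideanSpace ℝ (Fin n) → ℝ) (x y : EuclideanSpace ℝ (Fin n)) : ℝ :=
  χ y * ρ (x - y)

/-- The sum of the second derivatives that fall on the mollifier. -/
noncomputable def mollifierMain (χ ρ : EuclideanSpace ℝ (Fin n) → ℝ)
    (x y : EuclideanSpace ℝ (Fin n)) : ℝ :=
  χ y * ∑ i, partialDeriv i (partialDeriv i ρ) (x - y)

/-- The kernel of the commutator of a Schrödinger operator with the regularisation. -/
noncomputable def mollifierError (h : ℝ) (W χ ρ : EuclideanSpace ℝ (Fin n) → ℝ)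
    (x y : EuclideanSpace ℝ (Fin n)) : ℝ :=
  -(h ^ 2 / 2) * ∑ i, (partialDeriv i (partialDeriv i χ) y * ρ (x - y)
      - 2 * (partialDeriv i χ y * partialDeriv i ρ (x - y)))
    + (W y - W x) * (χ y * ρ (x - y))

/-- The Schrödinger operator applied to the regularisation kernel in its second variable. -/
noncomputable def mollifierHamiltonian (h : ℝ) (W χ ρ : EuclideanSpace ℝ (Fin n) → ℝ)
    (x y : EuclideanSpace ℝ (Fin n)) : ℝ :=
  -(h ^ 2 / 2) * ∑ i, partialDeriv i (partialDeriv i (cutoffMollifier χ ρ x)) y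
    + W y * cutoffMollifier χ ρ x y

variable {χ ρ W : EuclideanSpace ℝ (Fin n) → ℝ} {h : ℝ}

/-- Leibniz rule in `y`. The cross term is negative because differentiating `ρ (x - y)` once in `y`
produces a sign. The potential is moved from `y` to `x`, outside the integral operator, at the price
of `W y - W x`. -/
theorem mollifierHamiltonian_eq (hχ : ContDiff ℝ ∞ χ) (hρ : ContDiff ℝ ∞ ρ)
    (x y : EuclideanSpace ℝ (Fin n)) :
    mollifierHamiltonian h W χ ρ x y = -(h ^ 2 / 2) * mollifierMain χ ρ x y +
      W x * cutoffMollifier χ ρ x y + mollifierError h W χ ρ x y := by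
  have hs : ContDiff ℝ ∞ (fun y => ρ (x - y)) := hρ.comp (contDiff_const.sub contDiff_id)
  have h1 : ∀ i, partialDeriv i (partialDeriv i (cutoffMollifier χ ρ x)) y =
      χ y * partialDeriv i (partialDeriv i ρ) (x - y) +
      (partialDeriv i (partialDeriv i χ) y * ρ (x - y)
      - 2 * (partialDeriv i χ y * partialDeriv i ρ (x - y))) := by
    intro i
    unfold partialDeriv
    have := congrFun (dirDeriv_dirDeriv_mul hχ hs (EuclideanSpace.basisFun (Fin n) ℝ i)) y
    rw [dirDeriv_dirDeriv_comp_const_sub hρ, dirDeriv_comp_const_sub hρ] at this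
    refine this.trans ?_
    ring
  unfold mollifierHamiltonian mollifierMain mollifierError
  simp_rw [h1]
  rw [Finset.sum_add_distrib, Finset.mul_sum Finset.univ _ (χ y)]
  unfold cutoffMollifier
  ring

theorem hasCompactSupport_uncurry_of_sub {k : EuclideanSpace ℝ (Fin n) → EuclideanSpace ℝ (Fin n) → ℝ}
    {K₁ K₂ : Set (EuclideanSpace ℝ (Fin n))} (h₁ : IsCompact K₁) (h₂ : IsCompact K₂)
    (hk : ∀ x y, k x y ≠ 0 → y ∈ K₁ ∧ x - y ∈ K₂) : HasCompactSupport (Function.uncurry k) := by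
  have hc : Continuous fun z : EuclideanSpace ℝ (Fin n) × EuclideanSpace ℝ (Fin n) =>
      (z.2 + z.1, z.1) := (continuous_snd.add continuous_fst).prodMk continuous_fst
  refine HasCompactSupport.of_support_subset_isCompact ((h₁.prod h₂).image hc) ?_
  rintro ⟨x, y⟩ hxy
  exact ⟨(y, x - y), ⟨(hk x y hxy).1, (hk x y hxy).2⟩, by simp⟩

theorem ContDiff.partialDeriv {F : Type*} [NormedAddCommGroup F] [NormedSpace ℝ F]
    {f : EuclideanSpace ℝ (Fin n) → F} (hf : ContDiff ℝ ∞ f) (i : Fin n) :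
    ContDiff ℝ ∞ (partialDeriv i f) := hf.dirDeriv _

theorem tsupport_partialDeriv_subset {F : Type*} [NormedAddCommGroup F] [NormedSpace ℝ F]
    (f : EuclideanSpace ℝ (Fin n) → F) (i : Fin n) :
    tsupport (partialDeriv i f) ⊆ tsupport f := tsupport_dirDeriv_subset f _

theorem partialDeriv_eq_zero_of_notMem {F : Type*} [NormedAddCommGroup F] [NormedSpace ℝ F]
    {f : EuclideanSpace ℝ (Fin n) → F} {x : EuclideanSpace ℝ (Fin n)} (hx : x ∉ tsupport f)
    (i : Fin n) : partialDeriv i f x = 0 :=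
  image_eq_zero_of_notMem_tsupport fun h => hx (tsupport_partialDeriv_subset f i h)

theorem partialDeriv_partialDeriv_eq_zero_of_notMem {F : Type*} [NormedAddCommGroup F]
    [NormedSpace ℝ F] {f : EuclideanSpace ℝ (Fin n) → F} {x : EuclideanSpace ℝ (Fin n)}
    (hx : x ∉ tsupport f) (i : Fin n) : partialDeriv i (partialDeriv i f) x = 0 :=
  partialDeriv_eq_zero_of_notMem (fun h => hx (tsupport_partialDeriv_subset f i h)) i

theorem continuous_cutoffMollifier (hχ : ContDiff ℝ ∞ χ) (hρ : ContDiff ℝ ∞ ρ) :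
    Continuous (Function.uncurry (cutoffMollifier χ ρ)) :=
  (hχ.continuous.comp continuous_snd).mul
    (hρ.continuous.comp (continuous_fst.sub continuous_snd))

theorem continuous_mollifierMain (hχ : ContDiff ℝ ∞ χ) (hρ : ContDiff ℝ ∞ ρ) :
    Continuous (Function.uncurry (mollifierMain χ ρ)) :=
  (hχ.continuous.comp continuous_snd).mul (continuous_finsetSum _ fun i _ =>
    ((hρ.partialDeriv i).partialDeriv i).continuous.comp (continuous_fst.sub continuous_snd))

theorem continuous_mollifierError (hχ : ContDiff ℝ ∞ χ) (hρ : ContDiff ℝ ∞ ρ)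
    (hW : ContDiff ℝ ∞ W) : Continuous (Function.uncurry (mollifierError h W χ ρ)) := by
  have hs : Continuous fun z : EuclideanSpace ℝ (Fin n) × EuclideanSpace ℝ (Fin n) => z.1 - z.2 :=
    continuous_fst.sub continuous_snd
  refine (continuous_const.mul (continuous_finsetSum _ fun i _ => ?_)).add
    (((hW.continuous.comp continuous_snd).sub (hW.continuous.comp continuous_fst)).mul
      (continuous_cutoffMollifier hχ hρ))
  exact ((((hχ.partialDeriv i).partialDeriv i).continuous.comp continuous_snd).mul
    (hρ.continuous.comp hs)).sub (continuous_const.mul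
      (((hχ.partialDeriv i).continuous.comp continuous_snd).mul
        ((hρ.partialDeriv i).continuous.comp hs)))

theorem mem_tsupport_of_cutoffMollifier_ne_zero (x y : EuclideanSpace ℝ (Fin n))
    (hxy : cutoffMollifier χ ρ x y ≠ 0) : y ∈ tsupport χ ∧ x - y ∈ tsupport ρ := by
  unfold cutoffMollifier at hxy
  exact ⟨subset_tsupport _ (left_ne_zero_of_mul hxy), subset_tsupport _ (right_ne_zero_of_mul hxy)⟩

theorem mem_tsupport_of_mollifierMain_ne_zero (x y : EuclideanSpace ℝ (Fin n))
    (hxy : mollifierMain χ ρ x y ≠ 0) : y ∈ tsupport χ ∧ x - y ∈ tsupport ρ := by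
  unfold mollifierMain at hxy
  refine ⟨subset_tsupport _ (left_ne_zero_of_mul hxy), ?_⟩
  by_contra hn
  exact hxy (by simp [partialDeriv_partialDeriv_eq_zero_of_notMem hn])

theorem mem_tsupport_of_mollifierError_ne_zero (x y : EuclideanSpace ℝ (Fin n))
    (hxy : mollifierError h W χ ρ x y ≠ 0) : y ∈ tsupport χ ∧ x - y ∈ tsupport ρ := by
  unfold mollifierError at hxy
  constructor <;> by_contra hn <;> refine hxy ?_
  · simp [partialDeriv_partialDeriv_eq_zero_of_notMem hn, partialDeriv_eq_zero_of_notMem hn,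
      image_eq_zero_of_notMem_tsupport hn]
  · simp [partialDeriv_eq_zero_of_notMem hn, image_eq_zero_of_notMem_tsupport hn]

theorem mem_tsupport_of_mollifierHamiltonian_ne_zero (hχ : ContDiff ℝ ∞ χ) (hρ : ContDiff ℝ ∞ ρ)
    (x y : EuclideanSpace ℝ (Fin n))
    (hxy : mollifierHamiltonian h W χ ρ x y ≠ 0) : y ∈ tsupport χ ∧ x - y ∈ tsupport ρ := by
  rw [mollifierHamiltonian_eq hχ hρ] at hxy
  by_contra hn
  have h1 := mt (mem_tsupport_of_cutoffMollifier_ne_zero x y) hn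
  have h2 := mt (mem_tsupport_of_mollifierMain_ne_zero x y) hn
  have h3 := mt (mem_tsupport_of_mollifierError_ne_zero (h := h) (W := W) x y) hn
  rw [not_not] at h1 h2 h3
  exact hxy (by rw [h1, h2, h3]; ring)

theorem continuous_mollifierHamiltonian (hχ : ContDiff ℝ ∞ χ) (hρ : ContDiff ℝ ∞ ρ)
    (hW : ContDiff ℝ ∞ W) : Continuous (Function.uncurry (mollifierHamiltonian h W χ ρ)) := by
  have : Function.uncurry (mollifierHamiltonian h W χ ρ) = fun z =>
      -(h ^ 2 / 2) * Function.uncurry (mollifierMain χ ρ) z +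
      W z.1 * Function.uncurry (cutoffMollifier χ ρ) z +
      Function.uncurry (mollifierError h W χ ρ) z := by
    funext ⟨x, y⟩
    exact mollifierHamiltonian_eq hχ hρ x y
  rw [this]
  exact ((continuous_const.mul (continuous_mollifierMain hχ hρ)).add
    ((hW.continuous.comp continuous_fst).mul (continuous_cutoffMollifier hχ hρ))).add
    (continuous_mollifierError hχ hρ hW)

/-- The reflection `x ↦ y + z - x` exchanges `x - y` and `x - z` up to sign, and `ρ` and its second
derivatives are even. Equivalently, convolution with `ρ` commutes with convolution with `Δρ`, and
both are symmetric. -/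
theorem integral_cutoffMollifier_mul_mollifierMain (hρ : ContDiff ℝ ∞ ρ)
    (hev : ∀ x, ρ (-x) = ρ x) (y z : EuclideanSpace ℝ (Fin n)) :
    ∫ x, cutoffMollifier χ ρ x y * mollifierMain χ ρ x z =
      ∫ x, mollifierMain χ ρ x y * cutoffMollifier χ ρ x z := by
  rw [← integral_sub_left_eq_self
    (fun x => mollifierMain χ ρ x y * cutoffMollifier χ ρ x z) volume (y + z)]
  refine integral_congr_ae (ae_of_all _ fun x => ?_)
  have e1 : y + z - x - y = -(x - z) := by abel
  have e2 : y + z - x - z = -(x - y) := by abel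
  have e3 : ∀ i (w : EuclideanSpace ℝ (Fin n)), partialDeriv i (partialDeriv i ρ) (-w) =
      partialDeriv i (partialDeriv i ρ) w := fun i w => dirDeriv_dirDeriv_even hρ hev _ w
  simp only [cutoffMollifier, mollifierMain, e1, e2, e3, hev]
  ring

/-- For fixed `x` the kernel `cutoffMollifier χ ρ x` is an admissible test function in the weak
equation. -/
theorem IsSchrodingerSolution.hasDerivAt_kernelOp {a₀ : 𝓢(EuclideanSpace ℝ (Fin n), ℂ)}
    {u : ℝ → Lp ℂ 2 (volume : Measure (EuclideanSpace ℝ (Fin n)))}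
    (hu : IsSchrodingerSolution h W a₀ u) (hh : 0 < h)
    (hχ : ContDiff ℝ ∞ χ) (hρ : ContDiff ℝ ∞ ρ) (hχc : HasCompactSupport χ)
    (x : EuclideanSpace ℝ (Fin n)) {s : ℝ} (hs : 0 < s) :
    HasDerivAt (fun s => kernelOp (cutoffMollifier χ ρ) (u s) x)
      ((Complex.I * h)⁻¹ * kernelOp (mollifierHamiltonian h W χ ρ) (u s) x) s := by
  have hp : ContDiff ℝ ∞ (cutoffMollifier χ ρ x) :=
    hχ.mul (hρ.comp (contDiff_const.sub contDiff_id))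
  have hpc : HasCompactSupport (cutoffMollifier χ ρ x) := hχc.mul_right
  have hpC : HasCompactSupport fun y => (cutoffMollifier χ ρ x y : ℂ) :=
    hpc.comp_left (g := ((↑) : ℝ → ℂ)) (by simp)
  have h1 := (hu.equation _ hp.ofReal_infty hpC s hs.le).hasDerivAt (Ici_mem_nhds hs)
  have hc : (Complex.I * (h : ℂ)) ≠ 0 := by simp [hh.ne']
  have h2 := h1.const_mul (Complex.I * (h : ℂ))⁻¹
  simp only [inv_mul_cancel_left₀ hc] at h2
  refine h2.congr_deriv ?_
  congr 1
  refine integral_congr_ae (ae_of_all _ fun y => ?_)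
  simp only
  rw [laplacian_eq_sum_dirDeriv hp.ofReal_infty]
  simp_rw [dirDeriv_ofReal hp, dirDeriv_ofReal (hp.dirDeriv _)]
  unfold mollifierHamiltonian partialDeriv
  push_cast
  ring

end Mollifier

/-! ### Scaled cutoffs and mollifiers, and the size of the commutator -/

section Bump

variable {n : ℕ}

/-- The smooth bump function centred at the origin with radii `r` and `2 * r`. -/
def bumpAt (n : ℕ) (r : ℝ) (hr : 0 < r) : ContDiffBump (0 : EuclideanSpace ℝ (Fin n)) :=
  ⟨r, 2 * r, hr, by linarith⟩

/-- A smooth bump function equal to one on the support of `bumpAt n 1`. -/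
def wideBump (n : ℕ) : ContDiffBump (0 : EuclideanSpace ℝ (Fin n)) :=
  ⟨2, 3, by norm_num, by norm_num⟩

theorem bumpAt_apply {r : ℝ} (hr : 0 < r) (x : EuclideanSpace ℝ (Fin n)) :
    bumpAt n r hr x = bumpAt n 1 one_pos (r⁻¹ • x) := by
  rw [ContDiffBump.apply, ContDiffBump.apply]
  simp only [bumpAt, sub_zero, inv_one, one_smul, mul_one, div_one]
  rw [mul_div_assoc, div_self hr.ne', mul_one]

/-- The closed ball of radius `2` is both the support of `bumpAt n 1` and a set on which `wideBump
n` equals one. -/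
theorem le_wideBump {g : EuclideanSpace ℝ (Fin n) → ℝ} {B : ℝ} (hB : 0 ≤ B)
    (hg : tsupport g ⊆ tsupport (bumpAt n 1 one_pos)) (hgB : ∀ x, |g x| ≤ B)
    (x : EuclideanSpace ℝ (Fin n)) : |g x| ≤ B * wideBump n x := by
  by_cases hx : x ∈ tsupport (bumpAt n 1 one_pos)
  · rw [(wideBump n).one_of_mem_closedBall, mul_one]
    · exact hgB x
    · rw [ContDiffBump.tsupport_eq] at hx
      simpa [bumpAt, wideBump] using hx
  · rw [image_eq_zero_of_notMem_tsupport (fun h => hx (hg h)), abs_zero]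
    exact mul_nonneg hB (wideBump n).nonneg

theorem exists_bound_bumpAt (n : ℕ) : ∃ B : ℝ, 0 ≤ B ∧
    ∀ (i : Fin n) (x : EuclideanSpace ℝ (Fin n)),
      (|partialDeriv i (bumpAt n 1 one_pos) x| ≤ B ∧
        |partialDeriv i (partialDeriv i (bumpAt n 1 one_pos)) x| ≤ B) ∧
      |partialDeriv i (bumpAt n 1 one_pos) x| ≤ B * wideBump n x := by
  have hs : ContDiff ℝ ∞ (bumpAt n 1 one_pos) := (bumpAt n 1 one_pos).contDiff
  have hc := (bumpAt n 1 one_pos).hasCompactSupport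
  have h1 : ∀ i : Fin n, ∃ C, ∀ x, ‖partialDeriv i (bumpAt n 1 one_pos) x‖ ≤ C := fun i =>
    (hc.dirDeriv _).exists_bound_of_continuous (hs.partialDeriv i).continuous
  have h2 : ∀ i : Fin n, ∃ C, ∀ x,
      ‖partialDeriv i (partialDeriv i (bumpAt n 1 one_pos)) x‖ ≤ C := fun i =>
    ((hc.dirDeriv _).dirDeriv _).exists_bound_of_continuous
      ((hs.partialDeriv i).partialDeriv i).continuous
  choose C₁ hC₁ using h1
  choose C₂ hC₂ using h2
  have h1n : ∀ i, 0 ≤ C₁ i := fun i => (norm_nonneg _).trans (hC₁ i 0)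
  have h2n : ∀ i, 0 ≤ C₂ i := fun i => (norm_nonneg _).trans (hC₂ i 0)
  have hs1 : ∀ i, C₁ i ≤ ∑ j, C₁ j := fun i =>
    Finset.single_le_sum (fun j _ => h1n j) (Finset.mem_univ i)
  have hs2 : ∀ i, C₂ i ≤ ∑ j, C₂ j := fun i =>
    Finset.single_le_sum (fun j _ => h2n j) (Finset.mem_univ i)
  have h1s : 0 ≤ ∑ j, C₁ j := Finset.sum_nonneg fun j _ => h1n j
  have h2s : 0 ≤ ∑ j, C₂ j := Finset.sum_nonneg fun j _ => h2n j
  have hb : ∀ i x, |partialDeriv i (bumpAt n 1 one_pos) x| ≤ ∑ j, C₁ j + ∑ j, C₂ j := fun i x => by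
    linarith [hC₁ i x, hs1 i, Real.norm_eq_abs (partialDeriv i (bumpAt n 1 one_pos) x)]
  refine ⟨∑ j, C₁ j + ∑ j, C₂ j, by positivity, fun i x => ⟨⟨hb i x, ?_⟩, ?_⟩⟩
  · linarith [hC₂ i x, hs2 i,
      Real.norm_eq_abs (partialDeriv i (partialDeriv i (bumpAt n 1 one_pos)) x)]
  · exact le_wideBump (by positivity) (tsupport_partialDeriv_subset _ i) (hb i) x

theorem partialDeriv_comp_smul {f : EuclideanSpace ℝ (Fin n) → ℝ} (hf : ContDiff ℝ ∞ f) (a : ℝ)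
    (i : Fin n) : partialDeriv i (fun x => f (a • x)) = fun x => a * partialDeriv i f (a • x) :=
  dirDeriv_comp_smul hf a _

theorem partialDeriv_const_mul {f : EuclideanSpace ℝ (Fin n) → ℝ} (hf : ContDiff ℝ ∞ f) (a : ℝ)
    (i : Fin n) : partialDeriv i (fun x => a * f x) = fun x => a * partialDeriv i f x :=
  dirDeriv_const_mul hf a _

theorem partialDeriv_bumpAt {r : ℝ} (hr : 0 < r) (i : Fin n) (x : EuclideanSpace ℝ (Fin n)) :
    partialDeriv i (bumpAt n r hr) x =
      r⁻¹ * partialDeriv i (bumpAt n 1 one_pos) (r⁻¹ • x) := by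
  have : (bumpAt n r hr : EuclideanSpace ℝ (Fin n) → ℝ) =
      fun x => bumpAt n 1 one_pos (r⁻¹ • x) := funext (bumpAt_apply hr)
  rw [this, partialDeriv_comp_smul (bumpAt n 1 one_pos).contDiff]

theorem partialDeriv_partialDeriv_bumpAt {r : ℝ} (hr : 0 < r) (i : Fin n)
    (x : EuclideanSpace ℝ (Fin n)) :
    partialDeriv i (partialDeriv i (bumpAt n r hr)) x =
      r⁻¹ * (r⁻¹ * partialDeriv i (partialDeriv i (bumpAt n 1 one_pos)) (r⁻¹ • x)) := by
  have hs : ContDiff ℝ ∞ (bumpAt n 1 one_pos) := (bumpAt n 1 one_pos).contDiff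
  rw [show partialDeriv i (bumpAt n r hr) = fun x => r⁻¹ *
    partialDeriv i (bumpAt n 1 one_pos) (r⁻¹ • x) from funext (partialDeriv_bumpAt hr i),
    partialDeriv_const_mul, partialDeriv_comp_smul (hs.partialDeriv i)]
  exact (hs.partialDeriv i).comp (contDiff_const_smul _)

/-- The mollifier at scale `η`. -/
noncomputable def mollifier (n : ℕ) (η : ℝ) (hη : 0 < η) : EuclideanSpace ℝ (Fin n) → ℝ :=
  (bumpAt n η hη).normed volume

/-- A profile at scale `η` that dominates the mollifier and its derivatives. -/
noncomputable def mollifierEnvelope (n : ℕ) (η : ℝ) (hη : 0 < η) (x : EuclideanSpace ℝ (Fin n)) :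
    ℝ :=
  (∫ y, bumpAt n η hη y)⁻¹ * wideBump n (η⁻¹ • x)

theorem mollifier_eq {η : ℝ} (hη : 0 < η) :
    mollifier n η hη = fun x => (∫ y, bumpAt n η hη y)⁻¹ * bumpAt n η hη x := by
  funext x
  rw [mollifier, ContDiffBump.normed_def, div_eq_inv_mul]

theorem mollifier_le_envelope {η : ℝ} (hη : 0 < η) (x : EuclideanSpace ℝ (Fin n)) :
    |mollifier n η hη x| ≤ mollifierEnvelope n η hη x := by
  have hm : 0 < ∫ y, bumpAt n η hη y := (bumpAt n η hη).integral_pos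
  rw [mollifier_eq, mollifierEnvelope, abs_mul, abs_of_pos (inv_pos.2 hm), bumpAt_apply hη]
  gcongr
  have := le_wideBump (g := bumpAt n 1 one_pos) zero_le_one subset_rfl
    (fun x => by rw [abs_of_nonneg (bumpAt n 1 one_pos).nonneg]; exact (bumpAt n 1 one_pos).le_one)
    (η⁻¹ • x)
  rwa [one_mul] at this

theorem partialDeriv_mollifier {η : ℝ} (hη : 0 < η) (i : Fin n) (x : EuclideanSpace ℝ (Fin n)) :
    partialDeriv i (mollifier n η hη) x = (∫ y, bumpAt n η hη y)⁻¹ *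
      (η⁻¹ * partialDeriv i (bumpAt n 1 one_pos) (η⁻¹ • x)) := by
  rw [mollifier_eq, partialDeriv_const_mul (bumpAt n η hη).contDiff]
  simp only
  rw [partialDeriv_bumpAt hη]

/-- The Jacobian factors of the two rescaled bumps cancel, so the `L¹` norm of the envelope does not
depend on `η`. -/
theorem integral_mollifierEnvelope {η : ℝ} (hη : 0 < η) :
    ∫ x, mollifierEnvelope n η hη x = (∫ x, bumpAt n 1 one_pos x)⁻¹ * ∫ x, wideBump n x := by
  unfold mollifierEnvelope
  rw [integral_const_mul, Measure.integral_comp_smul volume (wideBump n)]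
  simp_rw [bumpAt_apply hη]
  rw [Measure.integral_comp_smul volume (bumpAt n 1 one_pos)]
  have hp : |(η⁻¹ ^ Module.finrank ℝ (EuclideanSpace ℝ (Fin n)))⁻¹| ≠ 0 := by positivity
  have hm : 0 < ∫ y, bumpAt n 1 one_pos y := (bumpAt n 1 one_pos).integral_pos
  simp only [smul_eq_mul]
  field_simp

theorem continuous_mollifierEnvelope {η : ℝ} (hη : 0 < η) :
    Continuous (mollifierEnvelope n η hη) :=
  continuous_const.mul ((wideBump n).continuous.comp (continuous_const_smul _))

theorem hasCompactSupport_mollifierEnvelope {η : ℝ} (hη : 0 < η) :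
    HasCompactSupport (mollifierEnvelope n η hη) :=
  ((wideBump n).hasCompactSupport.comp_smul (inv_ne_zero hη.ne')).mul_left

theorem mollifierEnvelope_nonneg {η : ℝ} (hη : 0 < η) (x : EuclideanSpace ℝ (Fin n)) :
    0 ≤ mollifierEnvelope n η hη x :=
  mul_nonneg (inv_nonneg.2 (bumpAt n η hη).integral_pos.le) (wideBump n).nonneg

/-- The semiclassical parameter is written as `R * η`. Derivatives of the cutoff cost `1 / R` and
those of the mollifier `1 / η`, while on the support `W` varies by at most a multiple of `R * η`.
Hence each commutator term is `O(R * η)`. -/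
theorem exists_mollifierError_bound (n : ℕ) {A : ℝ} (hA : 0 ≤ A) : ∃ C : ℝ, 0 ≤ C ∧
    ∀ (W : EuclideanSpace ℝ (Fin n) → ℝ),
      (∀ x y, |W x - W y| ≤ A * (1 + ‖x‖ + ‖y‖) * ‖x - y‖) →
      ∀ (R η : ℝ) (hR : 1 ≤ R) (hη : 0 < η), R * η ≤ 1 →
        ∀ x y, |mollifierError (R * η) W (bumpAt n R (one_pos.trans_le hR)) (mollifier n η hη) x y|
          ≤ C * (R * η) * mollifierEnvelope n η hη (x - y) := by
  obtain ⟨B, hB, hb⟩ := exists_bound_bumpAt n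
  refine ⟨n * (B + 2 * B ^ 2) + 14 * A, by positivity, fun W hW R η hR hη hRη x y => ?_⟩
  have hR0 : 0 < R := one_pos.trans_le hR
  set q := mollifierEnvelope n η hη (x - y) with hq
  have hq0 : 0 ≤ q := mollifierEnvelope_nonneg hη _
  have hm : 0 < ∫ y, bumpAt n η hη y := (bumpAt n η hη).integral_pos
  have hρ : |mollifier n η hη (x - y)| ≤ q := mollifier_le_envelope hη _
  have hterm : ∀ i : Fin n, |partialDeriv i (partialDeriv i (bumpAt n R hR0)) y *
      mollifier n η hη (x - y)
      - 2 * (partialDeriv i (bumpAt n R hR0) y * partialDeriv i (mollifier n η hη) (x - y))| ≤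
      (R⁻¹ * (R⁻¹ * B)) * q + 2 * ((R⁻¹ * B) * (η⁻¹ * B * q)) := by
    intro i
    have e1 : |partialDeriv i (partialDeriv i (bumpAt n R hR0)) y| ≤ R⁻¹ * (R⁻¹ * B) := by
      rw [partialDeriv_partialDeriv_bumpAt, abs_mul, abs_mul, abs_of_pos (inv_pos.2 hR0)]
      gcongr
      exact (hb i _).1.2
    have e2 : |partialDeriv i (bumpAt n R hR0) y| ≤ R⁻¹ * B := by
      rw [partialDeriv_bumpAt, abs_mul, abs_of_pos (inv_pos.2 hR0)]
      gcongr
      exact (hb i _).1.1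
    have e3 : |partialDeriv i (mollifier n η hη) (x - y)| ≤ η⁻¹ * B * q := by
      rw [partialDeriv_mollifier, abs_mul, abs_mul, abs_of_pos (inv_pos.2 hη),
        abs_of_pos (inv_pos.2 hm), hq, mollifierEnvelope]
      calc (∫ y, bumpAt n η hη y)⁻¹ *
            (η⁻¹ * |partialDeriv i (bumpAt n 1 one_pos) (η⁻¹ • (x - y))|)
          ≤ (∫ y, bumpAt n η hη y)⁻¹ * (η⁻¹ * (B * wideBump n (η⁻¹ • (x - y)))) := by
            gcongr
            exact (hb i _).2
        _ = _ := by ring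
    refine (abs_sub _ _).trans ?_
    rw [abs_mul, abs_mul, abs_mul, abs_of_pos (two_pos : (0 : ℝ) < 2)]
    gcongr
  have hsum : |∑ i : Fin n, (partialDeriv i (partialDeriv i (bumpAt n R hR0)) y *
      mollifier n η hη (x - y)
      - 2 * (partialDeriv i (bumpAt n R hR0) y * partialDeriv i (mollifier n η hη) (x - y)))| ≤
      n * ((R⁻¹ * (R⁻¹ * B)) * q + 2 * ((R⁻¹ * B) * (η⁻¹ * B * q))) := by
    refine (Finset.abs_sum_le_sum_abs _ _).trans ((Finset.sum_le_sum fun i _ => hterm i).trans (le_of_eq ?_))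
    simp
    ring
  have hpot : |(W y - W x) * (bumpAt n R hR0 y * mollifier n η hη (x - y))| ≤
      14 * A * (R * η) * q := by
    by_cases hy : y ∈ tsupport (bumpAt n R hR0)
    · by_cases hxy : x - y ∈ tsupport (mollifier n η hη)
      · rw [ContDiffBump.tsupport_eq] at hy
        rw [mollifier, ContDiffBump.tsupport_normed_eq] at hxy
        have hy' : ‖y‖ ≤ 2 * R := by simpa [bumpAt] using hy
        have hxy' : ‖x - y‖ ≤ 2 * η := by simpa [bumpAt] using hxy
        -- Here `η ≤ R * η ≤ 1 ≤ R`; with it `1 + 4 R + 2 η ≤ 7 R`, the source of the constant `14 =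
        -- 7 * 2`.
        have hη1 : η ≤ R := by nlinarith
        have hx' : ‖x‖ ≤ 2 * R + 2 * η := by
          calc ‖x‖ = ‖y + (x - y)‖ := by congr 1; abel
            _ ≤ _ := (norm_add_le _ _).trans (by linarith)
        have hWxy : |W y - W x| ≤ 14 * A * (R * η) := by
          rw [abs_sub_comm]
          calc |W x - W y| ≤ A * (1 + ‖x‖ + ‖y‖) * ‖x - y‖ := hW x y
            _ ≤ A * (1 + (2 * R + 2 * η) + 2 * R) * (2 * η) := by gcongr
            _ ≤ A * (7 * R) * (2 * η) := by gcongr; linarith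
            _ = _ := by ring
        rw [abs_mul, abs_mul, abs_of_nonneg (bumpAt n R hR0).nonneg]
        calc |W y - W x| * (bumpAt n R hR0 y * |mollifier n η hη (x - y)|)
            ≤ 14 * A * (R * η) * (1 * q) := by
              gcongr
              · exact mul_nonneg (bumpAt n R hR0).nonneg (abs_nonneg _)
              · exact (bumpAt n R hR0).le_one
          _ = _ := by ring
      · rw [image_eq_zero_of_notMem_tsupport hxy]
        simp only [mul_zero, abs_zero]
        positivity
    · rw [image_eq_zero_of_notMem_tsupport hy]
      simp only [zero_mul, mul_zero, abs_zero]
      positivity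
  unfold mollifierError
  refine (abs_add_le _ _).trans ?_
  rw [abs_mul, abs_neg, abs_of_nonneg (by positivity : 0 ≤ (R * η) ^ 2 / 2)]
  have hmain : (R * η) ^ 2 / 2 * (n * ((R⁻¹ * (R⁻¹ * B)) * q + 2 * ((R⁻¹ * B) * (η⁻¹ * B * q)))) ≤
      n * (B + 2 * B ^ 2) * (R * η) * q := by
    have hid : (R * η) ^ 2 / 2 *
        (n * ((R⁻¹ * (R⁻¹ * B)) * q + 2 * ((R⁻¹ * B) * (η⁻¹ * B * q)))) =
        n * (η ^ 2 * B / 2 + B ^ 2 * (R * η)) * q := by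
      field_simp
    rw [hid]
    have h1 : η ^ 2 ≤ R * η := by nlinarith
    have h2 : η ^ 2 * B / 2 + B ^ 2 * (R * η) ≤ (B + 2 * B ^ 2) * (R * η) := by
      have : 0 ≤ R * η := by positivity
      nlinarith [mul_le_mul_of_nonneg_right h1 hB, mul_nonneg this hB,
        mul_nonneg this (sq_nonneg B)]
    calc n * (η ^ 2 * B / 2 + B ^ 2 * (R * η)) * q
        ≤ n * ((B + 2 * B ^ 2) * (R * η)) * q := by gcongr
      _ = _ := by ring
  calc _ ≤ (R * η) ^ 2 / 2 * (n * ((R⁻¹ * (R⁻¹ * B)) * q + 2 * ((R⁻¹ * B) * (η⁻¹ * B * q)))) +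
        14 * A * (R * η) * q := by gcongr
    _ ≤ n * (B + 2 * B ^ 2) * (R * η) * q + 14 * A * (R * η) * q := by gcongr
    _ = _ := by ring

end Bump

/-! ### A priori mass bound for weak solutions with subquadratic potentials -/

section MassBound

variable {n : ℕ}

/-- Lebesgue differentiation: for large `k` the cutoff of radius `k + 1` equals one wherever the
mollifier around `x` is nonzero, so only the mollification remains. The radii are coupled so that
their product is `h`. -/
theorem tendsto_kernelOp_cutoffMollifier {h : ℝ} (hh : 0 < h)
    (f : Lp ℂ 2 (volume : Measure (EuclideanSpace ℝ (Fin n)))) :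
    ∀ᵐ x, Tendsto (fun k : ℕ => kernelOp (cutoffMollifier (bumpAt n (k + 1 : ℝ) (by positivity))
      (mollifier n (h / (k + 1)) (by positivity))) f x) atTop (𝓝 (f x)) := by
  have hlim : Tendsto (fun k : ℕ => 2 * (h / (k + 1 : ℝ))) atTop (𝓝 0) := by
    have h1 := (tendsto_const_div_atTop_nhds_zero_nat h).comp (tendsto_add_atTop_nat 1)
    have := h1.const_mul 2
    simpa [Function.comp_def] using this
  have hloc : LocallyIntegrable f (volume : Measure (EuclideanSpace ℝ (Fin n))) :=
    (Lp.memLp f).locallyIntegrable (by norm_num)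
  have key := ContDiffBump.ae_convolution_tendsto_right_of_locallyIntegrable
    (φ := fun k : ℕ => bumpAt n (h / (k + 1 : ℝ)) (by positivity)) (l := atTop) (K := 2)
    hlim (Eventually.of_forall fun k => le_rfl) hloc
  filter_upwards [key] with x hx
  refine hx.congr' ?_
  filter_upwards [eventually_ge_atTop ⌈‖x‖ + 2 * h⌉₊] with k hk
  have hk' : ‖x‖ + 2 * h ≤ k := Nat.ceil_le.1 hk
  rw [convolution_eq_swap]
  unfold kernelOp
  refine integral_congr_ae (ae_of_all _ fun y => ?_)
  simp only [ContinuousLinearMap.lsmul_apply, cutoffMollifier, mollifier]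
  by_cases hxy : (bumpAt n (h / (k + 1 : ℝ)) (by positivity)).normed volume (x - y) = 0
  · simp [hxy]
  · have hmem : x - y ∈ Metric.ball 0 (2 * (h / (k + 1 : ℝ))) := by
      have : x - y ∈ Function.support
          ((bumpAt n (h / (k + 1 : ℝ)) (by positivity)).normed volume) := hxy
      rwa [ContDiffBump.support_normed_eq] at this
    have hle : h / (k + 1 : ℝ) ≤ h := div_le_self hh.le (by linarith [Nat.cast_nonneg (α := ℝ) k])
    have hy : ‖y‖ ≤ k + 1 := by
      have h1 : ‖x - y‖ < 2 * (h / (k + 1 : ℝ)) := by simpa using hmem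
      calc ‖y‖ = ‖x - (x - y)‖ := by congr 1; abel
        _ ≤ ‖x‖ + ‖x - y‖ := norm_sub_le _ _
        _ ≤ _ := by linarith
    rw [(bumpAt n (k + 1 : ℝ) (by positivity)).one_of_mem_closedBall
      (by simpa [bumpAt] using hy), one_mul, Complex.real_smul, mul_comm]

/-- Fatou's lemma, in the form of lower semicontinuity of the `L²` norm under almost everywhere
convergence. -/
theorem norm_sq_le_of_ae_tendsto {α : Type*} [MeasurableSpace α] {μ : Measure α}
    (f : Lp ℂ 2 μ) {g : ℕ → α → ℂ} (hg : ∀ k, MemLp (g k) 2 μ)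
    (hlim : ∀ᵐ x ∂μ, Tendsto (fun k => g k x) atTop (𝓝 (f x))) {Z : ℝ}
    (hZ : ∀ k, ∫ x, ‖g k x‖ ^ 2 ∂μ ≤ Z) : ‖f‖ ^ 2 ≤ Z := by
  have hZ0 : 0 ≤ Z := (integral_nonneg fun x => by positivity).trans (hZ 0)
  have h1 : ∀ k, eLpNorm (g k) 2 μ ≤ ENNReal.ofReal (Real.sqrt Z) := by
    intro k
    have h2 := real_inner_self_eq_norm_sq (hg k).toLp
    rw [L2.inner_def] at h2
    have h3 : ∫ x, inner ℝ (MemLp.toLp (g k) (hg k) x) (MemLp.toLp (g k) (hg k) x) ∂μ = ∫ x, ‖g k x‖ ^ 2 ∂μ := by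
      refine integral_congr_ae ?_
      filter_upwards [(hg k).coeFn_toLp] with x hx
      rw [hx]
      exact real_inner_self_eq_norm_sq _
    have h4 : ‖(hg k).toLp‖ ≤ Real.sqrt Z := by
      refine Real.le_sqrt_of_sq_le ?_
      rw [← h2, h3]
      exact hZ k
    rw [Lp.norm_toLp] at h4
    exact (ENNReal.le_ofReal_iff_toReal_le (hg k).eLpNorm_ne_top (Real.sqrt_nonneg Z)).2 h4
  have h5 := Lp.eLpNorm_lim_le_liminf_eLpNorm (p := 2) (fun k => (hg k).aestronglyMeasurable)
    (f : α → ℂ) hlim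
  have h6 : eLpNorm f 2 μ ≤ ENNReal.ofReal (Real.sqrt Z) :=
    h5.trans (liminf_le_of_le (by isBoundedDefault) fun b hb => by
      obtain ⟨k, hk⟩ := hb.exists
      exact hk.trans (h1 k))
  have h7 : ‖f‖ ≤ Real.sqrt Z := by
    rw [Lp.norm_def]
    exact ENNReal.toReal_le_of_le_ofReal (Real.sqrt_nonneg Z) h6
  calc ‖f‖ ^ 2 ≤ Real.sqrt Z ^ 2 := by gcongr
    _ = Z := Real.sq_sqrt hZ0

/-- A priori bound for the mass of a weak solution, uniform in the semiclassical parameter. -/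
theorem exists_mass_bound (n : ℕ) {A : ℝ} (hA : 0 ≤ A) : ∃ K C : ℝ, 0 ≤ K ∧ 0 ≤ C ∧
    ∀ h ∈ Ioc (0 : ℝ) 1, ∀ W : EuclideanSpace ℝ (Fin n) → ℝ, ContDiff ℝ ∞ W →
      (∀ x y, |W x - W y| ≤ A * (1 + ‖x‖ + ‖y‖) * ‖x - y‖) →
      ∀ (a₀ : 𝓢(EuclideanSpace ℝ (Fin n), ℂ))
        (u : ℝ → Lp ℂ 2 (volume : Measure (EuclideanSpace ℝ (Fin n)))),
        IsSchrodingerSolution h W a₀ u → ∀ T M : ℝ, 0 < T → (∀ r ∈ Icc 0 T, ‖u r‖ ^ 2 ≤ M) →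
          ‖u T‖ ^ 2 ≤ K * ‖u 0‖ ^ 2 + C * M * T := by
  obtain ⟨C, hC, herr⟩ := exists_mollifierError_bound n hA
  set Q := (∫ x, bumpAt n 1 one_pos x)⁻¹ * ∫ x, wideBump n x with hQ
  refine ⟨Q ^ 2, 2 * C * Q ^ 2, by positivity, by positivity, ?_⟩
  intro h hh W hW hWA a₀ u hu T M hT hM
  have hpos : ∀ k : ℕ, 0 < (k + 1 : ℝ) := fun k => by positivity
  have hη : ∀ k : ℕ, 0 < h / (k + 1 : ℝ) := fun k => div_pos hh.1 (hpos k)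
  have hRη : ∀ k : ℕ, (k + 1 : ℝ) * (h / (k + 1 : ℝ)) = h := fun k =>
    mul_div_cancel₀ h (hpos k).ne'
  have hχ : ∀ k : ℕ, ContDiff ℝ ∞ (bumpAt n (k + 1 : ℝ) (hpos k)) := fun k =>
    (bumpAt n (k + 1 : ℝ) (hpos k)).contDiff
  have hρ : ∀ k : ℕ, ContDiff ℝ ∞ (mollifier n (h / (k + 1)) (hη k)) := fun k =>
    (bumpAt n (h / (k + 1)) (hη k)).contDiff_normed
  have hχc : ∀ k : ℕ, HasCompactSupport (bumpAt n (k + 1 : ℝ) (hpos k)) := fun k =>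
    (bumpAt n (k + 1 : ℝ) (hpos k)).hasCompactSupport
  have hρc : ∀ k : ℕ, HasCompactSupport (mollifier n (h / (k + 1)) (hη k)) := fun k =>
    (bumpAt n (h / (k + 1)) (hη k)).hasCompactSupport_normed
  have hpc : ∀ k : ℕ, HasCompactSupport (Function.uncurry
      (cutoffMollifier (bumpAt n (k + 1 : ℝ) (hpos k)) (mollifier n (h / (k + 1)) (hη k)))) :=
    fun k => hasCompactSupport_uncurry_of_sub (hχc k) (hρc k)
      mem_tsupport_of_cutoffMollifier_ne_zero
  have hpC := fun k => continuous_cutoffMollifier (hχ k) (hρ k)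
  refine norm_sq_le_of_ae_tendsto (u T) (fun k => memLp_kernelOp (hpC k) (hpc k) (u T))
    (tendsto_kernelOp_cutoffMollifier hh.1 (u T)) fun k => ?_
  have hstep : ∀ s ∈ Ioc 0 T, ∫ x, ‖kernelOp (cutoffMollifier (bumpAt n (k + 1 : ℝ) (hpos k))
      (mollifier n (h / (k + 1)) (hη k))) (u T) x‖ ^ 2 ≤
      Q ^ 2 * ‖u s‖ ^ 2 + 2 * C * Q ^ 2 * M * (T - s) := by
    intro s hs
    have hpq : ∀ x y, |cutoffMollifier (bumpAt n (k + 1 : ℝ) (hpos k))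
        (mollifier n (h / (k + 1)) (hη k)) x y| ≤
        mollifierEnvelope n (h / (k + 1)) (hη k) (x - y) := by
      intro x y
      unfold cutoffMollifier
      rw [abs_mul, abs_of_nonneg (bumpAt n (k + 1 : ℝ) (hpos k)).nonneg]
      calc _ ≤ 1 * mollifierEnvelope n (h / (k + 1)) (hη k) (x - y) := by
            gcongr
            · exact (bumpAt n (k + 1 : ℝ) (hpos k)).le_one
            · exact mollifier_le_envelope (hη k) _
        _ = _ := one_mul _
    have he := herr W hWA (k + 1) (h / (k + 1)) (by linarith [Nat.cast_nonneg (α := ℝ) k]) (hη k)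
      (by rw [hRη]; exact hh.2)
    rw [hRη] at he
    have hev : ∀ x, mollifier n (h / (k + 1)) (hη k) (-x) = mollifier n (h / (k + 1)) (hη k) x :=
      ContDiffBump.normed_neg _
    have := regularised_energy_le (hpC k) (hpc k) (continuous_mollifierMain (hχ k) (hρ k))
      (hasCompactSupport_uncurry_of_sub (hχc k) (hρc k) mem_tsupport_of_mollifierMain_ne_zero)
      (continuous_mollifierError (hχ k) (hρ k) hW)
      (hasCompactSupport_uncurry_of_sub (hχc k) (hρc k) mem_tsupport_of_mollifierError_ne_zero)
      (continuous_mollifierHamiltonian (hχ k) (hρ k) hW)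
      (hasCompactSupport_uncurry_of_sub (hχc k) (hρc k)
        (mem_tsupport_of_mollifierHamiltonian_ne_zero (hχ k) (hρ k)))
      (integral_cutoffMollifier_mul_mollifierMain (hρ k) hev)
      (mollifierHamiltonian_eq (hχ k) (hρ k))
      (continuous_mollifierEnvelope (hη k)) (hasCompactSupport_mollifierEnvelope (hη k))
      (mollifierEnvelope_nonneg (hη k)) hpq hC hh.1 he hu.continuousOn
      (fun x s hs => hu.hasDerivAt_kernelOp hh.1 (hχ k) (hρ k) (hχc k) x hs) hs.1 hs.2
      (fun r hr => hM r ⟨hs.1.le.trans hr.1, hr.2⟩)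
    rwa [integral_mollifierEnvelope] at this
  -- Strong continuity of `u` at `0` lets the starting time tend to zero, for each fixed
  -- regularisation.
  have hcont : Tendsto (fun s => Q ^ 2 * ‖u s‖ ^ 2 + 2 * C * Q ^ 2 * M * (T - s)) (𝓝[>] 0)
      (𝓝 (Q ^ 2 * ‖u 0‖ ^ 2 + 2 * C * Q ^ 2 * M * (T - 0))) := by
    have hu0 : Tendsto u (𝓝[>] 0) (𝓝 (u 0)) :=
      (hu.continuousOn 0 (mem_Ici.2 le_rfl)).mono_left (nhdsWithin_mono _ Ioi_subset_Ici_self)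
    have hid : Tendsto (fun s : ℝ => s) (𝓝[>] 0) (𝓝 0) := tendsto_id.mono_left nhdsWithin_le_nhds
    exact ((hu0.norm.pow 2).const_mul _).add ((hid.const_sub T).const_mul _)
  rw [sub_zero] at hcont
  exact ge_of_tendsto hcont (by
    filter_upwards [Ioc_mem_nhdsGT hT] with s hs using hstep s hs)

/-- Absorption argument: apply `exists_mass_bound` at a time where the mass is maximal. The length
`1 / (2 * (C + 1))` keeps the growth term below half of that maximum. -/
theorem exists_sup_norm_bound (n : ℕ) {A : ℝ} (hA : 0 ≤ A) : ∃ K T₀ : ℝ, 0 ≤ K ∧ 0 < T₀ ∧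
    ∀ h ∈ Ioc (0 : ℝ) 1, ∀ W : EuclideanSpace ℝ (Fin n) → ℝ, ContDiff ℝ ∞ W →
      (∀ x y, |W x - W y| ≤ A * (1 + ‖x‖ + ‖y‖) * ‖x - y‖) →
      ∀ (a₀ : 𝓢(EuclideanSpace ℝ (Fin n), ℂ))
        (u : ℝ → Lp ℂ 2 (volume : Measure (EuclideanSpace ℝ (Fin n)))),
        IsSchrodingerSolution h W a₀ u → ∀ t ∈ Icc 0 T₀, ‖u t‖ ≤ K * ‖u 0‖ := by
  obtain ⟨K, C, hK, hC, hmass⟩ := exists_mass_bound n hA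
  refine ⟨Real.sqrt (2 * (K + 1)), 1 / (2 * (C + 1)), Real.sqrt_nonneg _, by positivity, ?_⟩
  intro h hh W hW hWA a₀ u hu t ht
  have hcont : ContinuousOn (fun t => ‖u t‖ ^ 2) (Icc 0 (1 / (2 * (C + 1)))) :=
    (hu.continuousOn.mono Icc_subset_Ici_self).norm.pow 2
  obtain ⟨s, hs, hmax⟩ := isCompact_Icc.exists_isMaxOn ⟨t, ht⟩ hcont
  set M := ‖u s‖ ^ 2 with hMd
  have hM : ∀ r ∈ Icc (0 : ℝ) (1 / (2 * (C + 1))), ‖u r‖ ^ 2 ≤ M := fun r hr => hmax hr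
  have hM0 : 0 ≤ M := sq_nonneg _
  have hbd : M ≤ 2 * (K + 1) * ‖u 0‖ ^ 2 := by
    rcases hs.1.eq_or_lt with h0 | h0
    · rw [hMd, ← h0]
      nlinarith [sq_nonneg ‖u 0‖]
    · have h1 := hmass h hh W hW hWA a₀ u hu s M h0 fun r hr => hM r ⟨hr.1, hr.2.trans hs.2⟩
      have h2 : C * M * s ≤ M / 2 := by
        calc C * M * s ≤ C * M * (1 / (2 * (C + 1))) := by gcongr; exact hs.2
          _ = (C / (C + 1)) * (M / 2) := by field_simp
          _ ≤ 1 * (M / 2) := by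
            gcongr
            rw [div_le_one (by positivity)]
            linarith
          _ = M / 2 := one_mul _
      have h3 : M ≤ K * ‖u 0‖ ^ 2 + C * M * s := h1
      nlinarith [sq_nonneg ‖u 0‖]
  have := (hM t ht).trans hbd
  calc ‖u t‖ = Real.sqrt (‖u t‖ ^ 2) := (Real.sqrt_sq (norm_nonneg _)).symm
    _ ≤ Real.sqrt (2 * (K + 1) * ‖u 0‖ ^ 2) := Real.sqrt_le_sqrt this
    _ = _ := by rw [Real.sqrt_mul (by positivity), Real.sqrt_sq (norm_nonneg _)]

/-- A bounded Hessian gives a gradient of at most linear growth; the mean value inequality on the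
ball of radius `‖x‖ + ‖y‖` does the rest. Only derivatives of order two are needed. -/
theorem IsSubquadraticPotential.exists_lipschitz {V : EuclideanSpace ℝ (Fin n) → ℝ}
    (hV : IsSubquadraticPotential V) :
    ∃ A : ℝ, 0 ≤ A ∧ ∀ x y, |V x - V y| ≤ A * (1 + ‖x‖ + ‖y‖) * ‖x - y‖ := by
  obtain ⟨C, hC⟩ := hV.2 2 le_rfl
  have hC0 : 0 ≤ C := (norm_nonneg _).trans (hC 0)
  have hd : Differentiable ℝ (fderiv ℝ V) :=
    (hV.1.fderiv_right (m := ∞) (by simp)).differentiable_infty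
  have h2 : ∀ x, ‖fderiv ℝ (fderiv ℝ V) x‖ ≤ C := by
    intro x
    rw [← norm_iteratedFDeriv_one, norm_iteratedFDeriv_fderiv]
    exact hC x
  have h1 : ∀ x, ‖fderiv ℝ V x‖ ≤ ‖fderiv ℝ V 0‖ + C * ‖x‖ := by
    intro x
    have := convex_univ.norm_image_sub_le_of_norm_fderiv_le (𝕜 := ℝ) (f := fderiv ℝ V)
      (fun z _ => hd z) (fun z _ => h2 z) (mem_univ 0) (mem_univ x)
    rw [sub_zero] at this
    linarith [norm_le_norm_add_norm_sub' (fderiv ℝ V x) (fderiv ℝ V 0)]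
  set D := ‖fderiv ℝ V 0‖
  have hD : 0 ≤ D := norm_nonneg _
  refine ⟨D + C, by positivity, fun x y => ?_⟩
  have hr : ∀ z ∈ Metric.closedBall (0 : EuclideanSpace ℝ (Fin n)) (‖x‖ + ‖y‖),
      ‖fderiv ℝ V z‖ ≤ (D + C) * (1 + ‖x‖ + ‖y‖) := by
    intro z hz
    have hz' : ‖z‖ ≤ ‖x‖ + ‖y‖ := by simpa using hz
    have := h1 z
    nlinarith [norm_nonneg x, norm_nonneg y, mul_le_mul_of_nonneg_left hz' hC0,
      mul_nonneg hD (add_nonneg (norm_nonneg x) (norm_nonneg y))]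
  have := (convex_closedBall (0 : EuclideanSpace ℝ (Fin n))
    (‖x‖ + ‖y‖)).norm_image_sub_le_of_norm_fderiv_le (𝕜 := ℝ) (f := V)
    (fun z _ => hV.1.differentiable_infty z) hr (x := y) (y := x)
    (by simp [norm_nonneg]) (by simp [norm_nonneg])
  simpa [Real.norm_eq_abs] using this

end MassBound

/-! ### Differentiating a weak pairing against a moving test function -/

section MovingTestFunction

variable {E : Type*} [NormedAddCommGroup E] [NormedSpace ℝ E] [FiniteDimensional ℝ E]
  [MeasureSpace E] [BorelSpace E] [(volume : Measure E).IsAddHaarMeasure]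

theorem norm_toLp_le_of_norm_le {f g : E → ℂ} (hf : MemLp f 2 volume) (hg : MemLp g 2 volume)
    {c : ℝ} (hc : 0 ≤ c) (h : ∀ x, ‖f x‖ ≤ c * ‖g x‖) :
    ‖MemLp.toLp f hf‖ ≤ c * ‖MemLp.toLp g hg‖ := by
  rw [← abs_of_nonneg hc, ← Real.norm_eq_abs, ← norm_smul]
  refine Lp.norm_le_norm_of_ae_le ?_
  filter_upwards [hf.coeFn_toLp, hg.coeFn_toLp, Lp.coeFn_smul c (MemLp.toLp g hg)] with x h1 h2 h3
  rw [h1, h3, Pi.smul_apply, h2, norm_smul, Real.norm_of_nonneg hc]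
  exact h x

theorem continuousWithinAt_integral_mul {u : ℝ → Lp ℂ 2 (volume : Measure E)} {s : Set ℝ} {t : ℝ}
    (hu : ContinuousWithinAt u s t) {φ : E → ℂ} (hφ : MemLp φ 2 volume) :
    ContinuousWithinAt (fun r => ∫ x, u r x * φ x) s t := by
  simp_rw [integral_mul_eq_inner _ hφ]
  exact continuousWithinAt_const.inner hu

/-- Product rule for the pairing of a weakly differentiable curve with a moving test function. -/
theorem hasDerivWithinAt_integral_mul_moving {u : ℝ → Lp ℂ 2 (volume : Measure E)} {s : Set ℝ}
    {t : ℝ} (hu : ContinuousWithinAt u s t) {Φ : ℝ → E → ℂ} {Φ' N : E → ℂ}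
    (hΦ : ∀ r, MemLp (Φ r) 2 volume) (hΦ' : MemLp Φ' 2 volume) (hN : MemLp N 2 volume)
    (hbd : ∀ᶠ r in 𝓝 t, ∀ x, ‖Φ r x - Φ t x - ((r - t : ℝ) : ℂ) * Φ' x‖ ≤ (r - t) ^ 2 * ‖N x‖)
    {d : ℂ} (hd : HasDerivWithinAt (fun r => ∫ x, u r x * Φ t x) d s t) :
    HasDerivWithinAt (fun r => ∫ x, u r x * Φ r x) (d + ∫ x, u t x * Φ' x) s t := by
  have hc := continuousWithinAt_integral_mul hu hΦ'
  have hsplit : ∀ r, ∫ x, u r x * Φ r x = (∫ x, u r x * Φ t x) +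
      (((r - t : ℝ) : ℂ) * ∫ x, u r x * Φ' x) +
      ∫ x, u r x * (Φ r x - Φ t x - ((r - t : ℝ) : ℂ) * Φ' x) := by
    intro r
    have i1 := integrable_mul_of_memLp_two (u r) (hΦ t)
    have i2 := (integrable_mul_of_memLp_two (u r) hΦ').const_mul ((r - t : ℝ) : ℂ)
    have i3 := integrable_mul_of_memLp_two (u r) (((hΦ r).sub (hΦ t)).sub
      (hΦ'.const_mul ((r - t : ℝ) : ℂ)))
    rw [← integral_const_mul, ← integral_add i1 i2]
    have := integral_add (i1.add i2) i3
    simp only [Pi.add_apply, Pi.sub_apply] at this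
    rw [← this]
    refine integral_congr_ae (ae_of_all _ fun x => ?_)
    simp only
    ring
  -- The second factor is merely continuous, which suffices because `r - t` vanishes at the base
  -- point.
  have h2 : HasDerivWithinAt (fun r => ((r - t : ℝ) : ℂ) * ∫ x, u r x * Φ' x)
      (∫ x, u t x * Φ' x) s t := by
    rw [hasDerivWithinAt_iff_tendsto_slope]
    have hc' : Tendsto (fun r => ∫ x, u r x * Φ' x) (𝓝[s \ {t}] t) (𝓝 (∫ x, u t x * Φ' x)) :=
      hc.mono_left (nhdsWithin_mono _ sdiff_subset)
    refine hc'.congr' ?_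
    filter_upwards [self_mem_nhdsWithin] with r hr
    have hrt : ((r - t : ℝ) : ℂ) ≠ 0 := by
      rw [Complex.ofReal_ne_zero]
      exact sub_ne_zero.2 hr.2
    rw [slope_def_module, sub_self, Complex.ofReal_zero, zero_mul, sub_zero, Complex.real_smul,
      Complex.ofReal_inv, inv_mul_cancel_left₀ hrt]
  have h3 : HasDerivWithinAt
      (fun r => ∫ x, u r x * (Φ r x - Φ t x - ((r - t : ℝ) : ℂ) * Φ' x)) 0 s t := by
    rw [hasDerivWithinAt_iff_isLittleO]
    have hub : ∀ᶠ r in 𝓝[s] t, ‖u r‖ < ‖u t‖ + 1 :=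
      hu.norm.eventually (gt_mem_nhds (by linarith))
    have hO : (fun r => ∫ x, u r x * (Φ r x - Φ t x - ((r - t : ℝ) : ℂ) * Φ' x))
        =O[𝓝[s] t] fun r => (r - t) ^ 2 := by
      refine Asymptotics.IsBigO.of_bound (‖MemLp.toLp N hN‖ * (‖u t‖ + 1)) ?_
      filter_upwards [hub, nhdsWithin_le_nhds hbd] with r hr hr'
      have hm := ((hΦ r).sub (hΦ t)).sub (hΦ'.const_mul ((r - t : ℝ) : ℂ))
      have e1 := norm_integral_mul_le (u r) hm
      have e2 := norm_toLp_le_of_norm_le hm hN (sq_nonneg (r - t)) hr'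
      rw [Real.norm_of_nonneg (sq_nonneg (r - t))]
      calc _ ≤ _ := e1
        _ ≤ ((r - t) ^ 2 * ‖MemLp.toLp N hN‖) * (‖u t‖ + 1) := by gcongr
        _ = _ := by ring
    have ho : (fun r : ℝ => (r - t) ^ 2) =o[𝓝[s] t] fun r => r - t := by
      have h4 : Tendsto (fun r : ℝ => r - t) (𝓝[s] t) (𝓝 0) := by
        have : Tendsto (fun r : ℝ => r - t) (𝓝 t) (𝓝 (t - t)) :=
          (continuous_id.sub continuous_const).tendsto t
        rw [sub_self] at this
        exact this.mono_left nhdsWithin_le_nhds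
      have h5 := (Asymptotics.isLittleO_pow_id (𝕜 := ℝ) (one_lt_two)).comp_tendsto h4
      exact h5
    have := hO.trans_isLittleO ho
    simpa using this
  have h4 := (hd.add h2).add h3
  rw [add_zero] at h4
  exact h4.congr (fun r _ => hsplit r) (hsplit t)

end MovingTestFunction

/-! ### Test functions carrying the rotating phase -/

section Phase

variable {n : ℕ}

/-- The test function `χ` modulated by the phase `τ W`. -/
noncomputable def modulated (χ : EuclideanSpace ℝ (Fin n) → ℂ) (W : EuclideanSpace ℝ (Fin n) → ℝ)
    (τ : ℝ) (x : EuclideanSpace ℝ (Fin n)) : ℂ :=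
  χ x * Complex.exp (Complex.I * τ * W x)

variable {χ : EuclideanSpace ℝ (Fin n) → ℂ} {W : EuclideanSpace ℝ (Fin n) → ℝ}

theorem norm_exp_I_mul_mul (τ w : ℝ) : ‖Complex.exp (Complex.I * τ * w)‖ = 1 := by
  rw [mul_assoc, ← Complex.ofReal_mul, mul_comm, Complex.norm_exp_ofReal_mul_I]

theorem norm_modulated (τ : ℝ) (x : EuclideanSpace ℝ (Fin n)) : ‖modulated χ W τ x‖ = ‖χ x‖ := by
  rw [modulated, norm_mul, norm_exp_I_mul_mul, mul_one]

theorem contDiff_phase (hW : ContDiff ℝ ∞ W) (τ : ℝ) :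
    ContDiff ℝ ∞ fun x => Complex.I * τ * (W x : ℂ) :=
  contDiff_const.mul hW.ofReal_infty

theorem contDiff_modulated (hχ : ContDiff ℝ ∞ χ) (hW : ContDiff ℝ ∞ W) (τ : ℝ) :
    ContDiff ℝ ∞ (modulated χ W τ) :=
  hχ.mul (contDiff_phase hW τ).cexp

theorem hasCompactSupport_modulated (hχ : HasCompactSupport χ) (τ : ℝ) :
    HasCompactSupport (modulated χ W τ) := hχ.mul_right

theorem memLp_modulated (hχ : ContDiff ℝ ∞ χ) (hχc : HasCompactSupport χ) (hW : ContDiff ℝ ∞ W)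
    (τ : ℝ) : MemLp (modulated χ W τ) 2 volume :=
  (contDiff_modulated hχ hW τ).continuous.memLp_of_hasCompactSupport
    (hasCompactSupport_modulated hχc τ)

theorem tsupport_modulated_subset (τ : ℝ) : tsupport (modulated χ W τ) ⊆ tsupport χ :=
  tsupport_mul_subset_left

/-- Each derivative falling on the exponential brings down at most one factor `τ`, whence growth
quadratic in `τ`. -/
theorem norm_partialDeriv_partialDeriv_modulated_le (hχ : ContDiff ℝ ∞ χ) (hW : ContDiff ℝ ∞ W)
    {τ B D : ℝ} (hτ : 0 ≤ τ) (hB : 0 ≤ B) (hD : 0 ≤ D) (i : Fin n)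
    {x : EuclideanSpace ℝ (Fin n)}
    (hW1 : |partialDeriv i W x| ≤ B) (hW2 : |partialDeriv i (partialDeriv i W) x| ≤ B)
    (h0 : ‖χ x‖ ≤ D) (h1 : ‖partialDeriv i χ x‖ ≤ D)
    (h2 : ‖partialDeriv i (partialDeriv i χ) x‖ ≤ D) :
    ‖partialDeriv i (partialDeriv i (modulated χ W τ)) x‖ ≤
      3 * D * (1 + B) ^ 2 * (1 + τ) ^ 2 := by
  have hph := contDiff_phase hW τ
  have e1 : partialDeriv i (fun x => Complex.exp (Complex.I * τ * (W x : ℂ))) = fun x =>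
      Complex.exp (Complex.I * τ * (W x : ℂ)) * (Complex.I * τ * (partialDeriv i W x : ℝ)) := by
    unfold partialDeriv
    rw [dirDeriv_cexp hph, dirDeriv_const_mul hW.ofReal_infty, dirDeriv_ofReal hW]
  have e2 : partialDeriv i (partialDeriv i (fun x => Complex.exp (Complex.I * τ * (W x : ℂ)))) =
      fun x => Complex.exp (Complex.I * τ * (W x : ℂ)) *
        (Complex.I * τ * (partialDeriv i (partialDeriv i W) x : ℝ)) +
        Complex.exp (Complex.I * τ * (W x : ℂ)) * (Complex.I * τ * (partialDeriv i W x : ℝ)) *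
          (Complex.I * τ * (partialDeriv i W x : ℝ)) := by
    rw [e1]
    have hW' := (hW.partialDeriv i).ofReal_infty
    have := dirDeriv_mul hph.cexp (contDiff_const.mul hW' : ContDiff ℝ ∞
      fun x => Complex.I * τ * ((partialDeriv i W x : ℝ) : ℂ)) (EuclideanSpace.basisFun (Fin n) ℝ i)
    refine this.trans ?_
    rw [dirDeriv_const_mul hW', dirDeriv_ofReal (hW.partialDeriv i)]
    funext x
    rw [show dirDeriv (EuclideanSpace.basisFun (Fin n) ℝ i)
      (fun x => Complex.exp (Complex.I * τ * (W x : ℂ))) x = _ from congrFun e1 x]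
    rfl
  have e3 := congrFun (dirDeriv_dirDeriv_mul hχ hph.cexp (EuclideanSpace.basisFun (Fin n) ℝ i)) x
  have e4 : partialDeriv i (partialDeriv i (modulated χ W τ)) x =
      χ x * partialDeriv i (partialDeriv i (fun x => Complex.exp (Complex.I * τ * (W x : ℂ)))) x +
      2 * (partialDeriv i χ x *
        partialDeriv i (fun x => Complex.exp (Complex.I * τ * (W x : ℂ))) x) +
      partialDeriv i (partialDeriv i χ) x * Complex.exp (Complex.I * τ * (W x : ℂ)) := e3
  have hn1 : ‖Complex.I * τ * ((partialDeriv i W x : ℝ) : ℂ)‖ ≤ τ * B := by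
    rw [norm_mul, norm_mul, Complex.norm_I, Complex.norm_real, Complex.norm_real, one_mul,
      Real.norm_of_nonneg hτ, Real.norm_eq_abs]
    gcongr
  have hn2 : ‖Complex.I * τ * ((partialDeriv i (partialDeriv i W) x : ℝ) : ℂ)‖ ≤ τ * B := by
    rw [norm_mul, norm_mul, Complex.norm_I, Complex.norm_real, Complex.norm_real, one_mul,
      Real.norm_of_nonneg hτ, Real.norm_eq_abs]
    gcongr
  have hE := norm_exp_I_mul_mul τ (W x)
  have f1 : ‖partialDeriv i (fun x => Complex.exp (Complex.I * τ * (W x : ℂ))) x‖ ≤ τ * B := by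
    rw [e1, norm_mul, hE, one_mul]
    exact hn1
  have f2 : ‖partialDeriv i (partialDeriv i
      (fun x => Complex.exp (Complex.I * τ * (W x : ℂ)))) x‖ ≤ τ * B + τ * B * (τ * B) := by
    rw [e2]
    refine (norm_add_le _ _).trans (add_le_add ?_ ?_)
    · rw [norm_mul (Complex.exp _), hE, one_mul]
      exact hn2
    · rw [norm_mul, norm_mul (Complex.exp _), hE, one_mul]
      gcongr
  rw [e4]
  calc _ ≤ D * (τ * B + τ * B * (τ * B)) + 2 * (D * (τ * B)) + D * 1 := by
        refine (norm_add_le _ _).trans (add_le_add ((norm_add_le _ _).trans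
          (add_le_add ?_ ?_)) ?_)
        · rw [norm_mul]; gcongr
        · rw [norm_mul, norm_mul, Complex.norm_ofNat]; gcongr
        · rw [norm_mul, hE]; gcongr
    _ = D * (1 + 3 * (τ * B) + (τ * B) ^ 2) := by ring
    _ ≤ D * (3 * ((1 + B) * (1 + τ)) ^ 2) := by
        gcongr
        nlinarith [mul_nonneg hτ hB]
    _ = _ := by ring

/-- The constant depends on `W` only through the bound `B` on the support of `χ`, so it is uniform
over the potentials `V + δ h * V₁` as `h` varies. -/
theorem exists_norm_toLp_laplacian_modulated_le (hχ : ContDiff ℝ ∞ χ) (hχc : HasCompactSupport χ)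
    {B : ℝ} (hB : 0 ≤ B) : ∃ C : ℝ, 0 ≤ C ∧ ∀ W : EuclideanSpace ℝ (Fin n) → ℝ,
      ContDiff ℝ ∞ W →
      (∀ x ∈ tsupport χ, ∀ i, |partialDeriv i W x| ≤ B ∧
        |partialDeriv i (partialDeriv i W) x| ≤ B) →
      ∀ τ, 0 ≤ τ → ∀ f : Lp ℂ 2 (volume : Measure (EuclideanSpace ℝ (Fin n))),
        Integrable (fun x => f x * Laplacian.laplacian (modulated χ W τ) x) ∧
        ‖∫ x, f x * Laplacian.laplacian (modulated χ W τ) x‖ ≤ C * (1 + τ) ^ 2 * ‖f‖ := by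
  obtain ⟨D₀, hD₀⟩ := hχc.exists_bound_of_continuous hχ.continuous
  have h1 : ∀ i : Fin n, ∃ C, ∀ x, ‖partialDeriv i χ x‖ ≤ C := fun i =>
    (hχc.dirDeriv _).exists_bound_of_continuous (hχ.partialDeriv i).continuous
  have h2 : ∀ i : Fin n, ∃ C, ∀ x, ‖partialDeriv i (partialDeriv i χ) x‖ ≤ C := fun i =>
    ((hχc.dirDeriv _).dirDeriv _).exists_bound_of_continuous
      ((hχ.partialDeriv i).partialDeriv i).continuous
  choose D₁ hD₁ using h1
  choose D₂ hD₂ using h2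
  have n0 : 0 ≤ D₀ := (norm_nonneg _).trans (hD₀ 0)
  have n1 : ∀ i, 0 ≤ D₁ i := fun i => (norm_nonneg _).trans (hD₁ i 0)
  have n2 : ∀ i, 0 ≤ D₂ i := fun i => (norm_nonneg _).trans (hD₂ i 0)
  set G : ℝ := ∑ i : Fin n, 3 * (D₀ + D₁ i + D₂ i) * (1 + B) ^ 2 with hG
  have hG0 : 0 ≤ G := Finset.sum_nonneg fun i _ => by
    have := n1 i; have := n2 i; positivity
  have hg := memLp_indicator_const (μ := (volume : Measure (EuclideanSpace ℝ (Fin n)))) 2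
    hχc.measurableSet (G : ℂ) (Or.inr hχc.isCompact.measure_lt_top.ne)
  refine ⟨‖MemLp.toLp _ hg‖, norm_nonneg _, fun W hW hWB τ hτ f => ?_⟩
  have hm := contDiff_modulated hχ hW τ
  have hlap : Laplacian.laplacian (modulated χ W τ) = fun x =>
      ∑ i, partialDeriv i (partialDeriv i (modulated χ W τ)) x :=
    funext (laplacian_eq_sum_dirDeriv hm)
  have hlc : Continuous (Laplacian.laplacian (modulated χ W τ)) := by
    rw [hlap]
    exact continuous_finsetSum _ fun i _ => ((hm.partialDeriv i).partialDeriv i).continuous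
  have hzero : ∀ x ∉ tsupport χ, Laplacian.laplacian (modulated χ W τ) x = 0 := by
    intro x hx
    rw [hlap]
    exact Finset.sum_eq_zero fun i _ =>
      partialDeriv_partialDeriv_eq_zero_of_notMem (fun h => hx (tsupport_modulated_subset τ h)) i
  have hlcs : HasCompactSupport (Laplacian.laplacian (modulated χ W τ)) :=
    HasCompactSupport.intro hχc.isCompact hzero
  have hL : MemLp (Laplacian.laplacian (modulated χ W τ)) 2 volume :=
    hlc.memLp_of_hasCompactSupport hlcs
  refine ⟨integrable_mul_of_memLp_two f hL, (norm_integral_mul_le f hL).trans ?_⟩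
  gcongr
  rw [mul_comm]
  refine norm_toLp_le_of_norm_le hL hg (sq_nonneg _) fun x => ?_
  by_cases hx : x ∈ tsupport χ
  · rw [indicator_of_mem hx, Complex.norm_real, Real.norm_of_nonneg hG0, hlap, hG, Finset.mul_sum]
    refine (norm_sum_le _ _).trans (Finset.sum_le_sum fun i _ => ?_)
    have hD : 0 ≤ D₀ + D₁ i + D₂ i := by have := n1 i; have := n2 i; positivity
    refine (norm_partialDeriv_partialDeriv_modulated_le hχ hW hτ hB hD i (hWB x hx i).1
      (hWB x hx i).2 ?_ ?_ ?_).trans (le_of_eq (by ring))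
    · linarith [hD₀ x, n1 i, n2 i]
    · linarith [hD₁ i x, n1 i, n2 i]
    · linarith [hD₂ i x, n1 i, n2 i]
  · rw [hzero x hx, norm_zero]
    positivity

/-- Second order Taylor bound for the exponential, uniform in `x` because `W / h` is bounded on the
support of `χ`: near `t` the phase increment has modulus at most one there. -/
theorem eventually_norm_modulated_sub_le (hχc : HasCompactSupport χ) (hW : Continuous W)
    (h t : ℝ) : ∀ᶠ r in 𝓝 t, ∀ x,
      ‖modulated χ W (r / h) x - modulated χ W (t / h) x -
        ((r - t : ℝ) : ℂ) * (Complex.I / h * (W x * modulated χ W (t / h) x))‖ ≤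
      (r - t) ^ 2 * ‖χ x * ((W x / h) ^ 2 : ℝ)‖ := by
  obtain ⟨D, hD⟩ := hχc.isCompact.exists_bound_of_continuousOn (f := fun x => W x / h)
    (hW.div_const h).continuousOn
  have hev : ∀ᶠ r in 𝓝 t, |r - t| * D < 1 := by
    have hc : Continuous fun r : ℝ => |r - t| * D := by fun_prop
    exact (hc.tendsto t).eventually (gt_mem_nhds (by simp))
  filter_upwards [hev] with r hr x
  by_cases hx : x ∈ tsupport χ
  · set θ : ℂ := Complex.I * ((r - t) * (W x / h) : ℝ) with hθ
    have hθn : ‖θ‖ = |r - t| * |W x / h| := by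
      rw [hθ, norm_mul, Complex.norm_I, one_mul, Complex.norm_real, Real.norm_eq_abs, abs_mul]
    have hθ1 : ‖θ‖ ≤ 1 := by
      rw [hθn]
      refine le_trans ?_ hr.le
      gcongr
      exact hD x hx
    have hexp := Complex.norm_exp_sub_one_sub_id_le hθ1
    have hsplit : Complex.exp (Complex.I * ((r / h : ℝ) : ℂ) * W x) =
        Complex.exp (Complex.I * ((t / h : ℝ) : ℂ) * W x) * Complex.exp θ := by
      rw [← Complex.exp_add]
      congr 1
      rw [hθ]
      push_cast
      ring
    have heq : modulated χ W (r / h) x - modulated χ W (t / h) x -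
        ((r - t : ℝ) : ℂ) * (Complex.I / h * (W x * modulated χ W (t / h) x)) =
        modulated χ W (t / h) x * (Complex.exp θ - 1 - θ) := by
      unfold modulated
      rw [hsplit, hθ]
      push_cast
      ring
    rw [heq, norm_mul, norm_modulated, norm_mul, Complex.norm_real, Real.norm_eq_abs,
      abs_of_nonneg (sq_nonneg (W x / h))]
    calc ‖χ x‖ * ‖Complex.exp θ - 1 - θ‖ ≤ ‖χ x‖ * ‖θ‖ ^ 2 := by gcongr
      _ = _ := by rw [hθn, mul_pow, sq_abs, sq_abs]; ring
  · simp [modulated, image_eq_zero_of_notMem_tsupport hx]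

theorem integral_mul_hamiltonian {h : ℝ} {φ : EuclideanSpace ℝ (Fin n) → ℂ}
    (f : Lp ℂ 2 (volume : Measure (EuclideanSpace ℝ (Fin n))))
    (h1 : Integrable (fun x => f x * Laplacian.laplacian φ x))
    (h2 : Integrable (fun x => f x * ((W x : ℂ) * φ x))) :
    ∫ x, f x * (-((h : ℂ) ^ 2 / 2) * Laplacian.laplacian φ x + (W x : ℂ) * φ x) =
      -((h : ℂ) ^ 2 / 2) * (∫ x, f x * Laplacian.laplacian φ x) +
      ∫ x, f x * ((W x : ℂ) * φ x) := by
  rw [← integral_const_mul, ← integral_add (h1.const_mul _) h2]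
  refine integral_congr_ae (ae_of_all _ fun x => ?_)
  simp only
  ring

/-- Here `X` stands for the pairing with the Laplacian and `Y` for the one with the potential. The
time derivative of the phase removes `Y`, the only term of order `1 / h`. -/
theorem transport_cancellation {h X Y : ℂ} (hh : h ≠ 0) :
    (Complex.I * h)⁻¹ * (-(h ^ 2 / 2) * X + Y) + Complex.I / h * Y = Complex.I * h / 2 * X := by
  rw [mul_inv, Complex.inv_I]
  field_simp
  ring

theorem IsSchrodingerSolution.hasDerivWithinAt_modulated {h : ℝ} (hh : 0 < h)
    {a₀ : 𝓢(EuclideanSpace ℝ (Fin n), ℂ)}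
    {u : ℝ → Lp ℂ 2 (volume : Measure (EuclideanSpace ℝ (Fin n)))}
    (hu : IsSchrodingerSolution h W a₀ u) (hχ : ContDiff ℝ ∞ χ) (hχc : HasCompactSupport χ)
    (hW : ContDiff ℝ ∞ W) {t : ℝ} (ht : 0 ≤ t)
    (hint : Integrable (fun x => u t x * Laplacian.laplacian (modulated χ W (t / h)) x)) :
    HasDerivWithinAt (fun r => ∫ x, u r x * modulated χ W (r / h) x)
      (Complex.I * h / 2 * ∫ x, u t x * Laplacian.laplacian (modulated χ W (t / h)) x)
      (Ici 0) t := by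
  have hh' : (h : ℂ) ≠ 0 := by exact_mod_cast hh.ne'
  have hc : (Complex.I * (h : ℂ)) ≠ 0 := mul_ne_zero Complex.I_ne_zero hh'
  have hm := contDiff_modulated hχ hW (t / h)
  have hmc := hasCompactSupport_modulated (W := W) hχc (t / h)
  have hWm : MemLp (fun x => (W x : ℂ) * modulated χ W (t / h) x) 2 volume :=
    ((Complex.continuous_ofReal.comp hW.continuous).mul hm.continuous).memLp_of_hasCompactSupport
      hmc.mul_left
  have hN : MemLp (fun x => χ x * ((W x / h) ^ 2 : ℝ)) 2 volume :=
    (hχ.continuous.mul (Complex.continuous_ofReal.comp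
      ((hW.continuous.div_const h).pow 2))).memLp_of_hasCompactSupport hχc.mul_right
  have h1 := (hu.equation _ hm hmc t ht).const_mul (Complex.I * (h : ℂ))⁻¹
  simp only [inv_mul_cancel_left₀ hc] at h1
  rw [integral_mul_hamiltonian (u t) hint (integrable_mul_of_memLp_two (u t) hWm)] at h1
  have h2 := hasDerivWithinAt_integral_mul_moving (hu.continuousOn t ht)
    (fun r => memLp_modulated hχ hχc hW (r / h)) (hWm.const_mul (Complex.I / h)) hN
    (eventually_norm_modulated_sub_le hχc hW.continuous h t) h1
  have e2 : ∫ x, u t x * (Complex.I / h * ((W x : ℂ) * modulated χ W (t / h) x)) =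
      Complex.I / h * ∫ x, u t x * ((W x : ℂ) * modulated χ W (t / h) x) := by
    rw [← integral_const_mul]
    refine integral_congr_ae (ae_of_all _ fun x => ?_)
    simp only
    ring
  rw [e2, transport_cancellation hh'] at h2
  exact h2

/-- A solution stays close to its initial datum with rotating phase when tested against a fixed
smooth compactly supported profile, for times small compared with `h ^ (1 / 3)`. -/
theorem exists_pairing_modulated_le (hχ : ContDiff ℝ ∞ χ) (hχc : HasCompactSupport χ)
    {B : ℝ} (hB : 0 ≤ B) : ∃ C : ℝ, 0 ≤ C ∧ ∀ h : ℝ, 0 < h →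
      ∀ W : EuclideanSpace ℝ (Fin n) → ℝ, ContDiff ℝ ∞ W →
      (∀ x ∈ tsupport χ, ∀ i, |partialDeriv i W x| ≤ B ∧
        |partialDeriv i (partialDeriv i W) x| ≤ B) →
      ∀ (a₀ : 𝓢(EuclideanSpace ℝ (Fin n), ℂ))
        (u : ℝ → Lp ℂ 2 (volume : Measure (EuclideanSpace ℝ (Fin n)))),
        IsSchrodingerSolution h W a₀ u → ∀ T M : ℝ, 0 ≤ T → (∀ t ∈ Icc 0 T, ‖u t‖ ≤ M) →
          ‖(∫ x, u T x * modulated χ W (T / h) x) - ∫ x, u 0 x * χ x‖ ≤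
            C * M * (h * T * (1 + T / h) ^ 2) := by
  obtain ⟨C, hC, hlap⟩ := exists_norm_toLp_laplacian_modulated_le hχ hχc hB
  refine ⟨C, hC, fun h hh W hW hWB a₀ u hu T M hT hM => ?_⟩
  have hM0 : 0 ≤ M := (norm_nonneg _).trans (hM 0 ⟨le_rfl, hT⟩)
  have key := (convex_Icc 0 T).norm_image_sub_le_of_norm_hasDerivWithin_le
    (f := fun r => ∫ x, u r x * modulated χ W (r / h) x)
    (C := h * (C * (1 + T / h) ^ 2 * M))
    (fun t ht => (hu.hasDerivWithinAt_modulated hh hχ hχc hW ht.1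
      (hlap W hW hWB (t / h) (div_nonneg ht.1 hh.le) (u t)).1).mono Icc_subset_Ici_self)
    (fun t ht => by
      have h1 := (hlap W hW hWB (t / h) (div_nonneg ht.1 hh.le) (u t)).2
      have h0 : 0 ≤ t / h := div_nonneg ht.1 hh.le
      rw [norm_mul]
      have h2 : ‖Complex.I * (h : ℂ) / 2‖ ≤ h := by
        rw [norm_div, norm_mul, Complex.norm_I, Complex.norm_real, Real.norm_of_nonneg hh.le,
          Complex.norm_ofNat]
        linarith
      have h3 : t / h ≤ T / h := div_le_div_of_nonneg_right ht.2 hh.le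
      refine mul_le_mul h2 (h1.trans ?_) (norm_nonneg _) hh.le
      gcongr
      exact hM t ht)
    (left_mem_Icc.2 hT) (right_mem_Icc.2 hT)
  have h0 : ∀ x, modulated χ W (0 / h) x = χ x := fun x => by simp [modulated]
  simp only [h0, sub_zero, Real.norm_of_nonneg hT] at key
  exact key.trans (le_of_eq (by ring))

end Phase

/-! ### Essential supremum in time, separating profile and time scales -/

section Conclusion

variable {n : ℕ}

/-- By continuity the strict inequality at `T` persists on an interval `(l, T)`, which has positive
measure, so the essential supremum sees it. -/
theorem ofReal_le_normLinftyL2 {w : ℝ → Lp ℂ 2 (volume : Measure (EuclideanSpace ℝ (Fin n)))}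
    (hw : ContinuousOn w (Ici 0)) {T c : ℝ} (hT : 0 < T) (hc : c < ‖w T‖) :
    ENNReal.ofReal c ≤ normLinftyL2 T w := by
  by_contra hlt
  rw [not_le, normLinftyL2, eLpNorm_exponent_top] at hlt
  have hae : ∀ᵐ s ∂(volume.restrict (Icc 0 T)), ‖w s‖ₑ < ENNReal.ofReal c :=
    (ae_le_eLpNormEssSup (f := w)).mono fun s hs => hs.trans_lt hlt
  have hev : ∀ᶠ s in 𝓝[<] T, c < ‖w s‖ :=
    ((hw.continuousAt (Ici_mem_nhds hT)).norm.eventually (lt_mem_nhds hc)).filter_mono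
      nhdsWithin_le_nhds
  obtain ⟨l, hl, hsub⟩ := (mem_nhdsLT_iff_exists_Ioo_subset' hT).1
    (hev.and (Ioo_mem_nhdsLT hT))
  have hzero : volume.restrict (Icc 0 T) (Ioo l T) = 0 := by
    refine measure_mono_null (fun s hs => ?_) hae
    have h1 := (hsub hs).1
    simp only [mem_compl_iff, mem_ofPred_eq, not_lt]
    rw [← ofReal_norm]
    exact ENNReal.ofReal_le_ofReal h1.le
  rw [Measure.restrict_apply measurableSet_Ioo, inter_eq_left.2 fun s hs =>
    Ioo_subset_Icc_self (hsub hs).2, Real.volume_Ioo, ENNReal.ofReal_eq_zero] at hzero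
  have : l < T := hl
  linarith

theorem exists_bound_partialDeriv {K : Set (EuclideanSpace ℝ (Fin n))} (hK : IsCompact K)
    {V : EuclideanSpace ℝ (Fin n) → ℝ} (hV : ContDiff ℝ ∞ V) :
    ∃ B : ℝ, 0 ≤ B ∧ ∀ x ∈ K, ∀ i, |partialDeriv i V x| ≤ B ∧
      |partialDeriv i (partialDeriv i V) x| ≤ B := by
  have h1 : ∀ i : Fin n, ∃ C, ∀ x ∈ K, ‖partialDeriv i V x‖ ≤ C := fun i =>
    hK.exists_bound_of_continuousOn (hV.partialDeriv i).continuous.continuousOn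
  have h2 : ∀ i : Fin n, ∃ C, ∀ x ∈ K, ‖partialDeriv i (partialDeriv i V) x‖ ≤ C := fun i =>
    hK.exists_bound_of_continuousOn ((hV.partialDeriv i).partialDeriv i).continuous.continuousOn
  choose C₁ hC₁ using h1
  choose C₂ hC₂ using h2
  have hs : ∀ i, |C₁ i| + |C₂ i| ≤ ∑ j, (|C₁ j| + |C₂ j|) := fun i =>
    Finset.single_le_sum (f := fun j => |C₁ j| + |C₂ j|) (fun j _ => by positivity)
      (Finset.mem_univ i)
  refine ⟨∑ j, (|C₁ j| + |C₂ j|), Finset.sum_nonneg fun j _ => by positivity, fun x hx i => ?_⟩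
  have e1 := hC₁ i x hx
  have e2 := hC₂ i x hx
  rw [Real.norm_eq_abs] at e1 e2
  constructor <;>
    linarith [hs i, le_abs_self (C₁ i), le_abs_self (C₂ i), abs_nonneg (C₁ i), abs_nonneg (C₂ i)]

theorem partialDeriv_add_const_mul {V V₁ : EuclideanSpace ℝ (Fin n) → ℝ} (hV : ContDiff ℝ ∞ V)
    (hV₁ : ContDiff ℝ ∞ V₁) (d : ℝ) (i : Fin n) :
    partialDeriv i (fun x => V x + d * V₁ x) =
      fun x => partialDeriv i V x + d * partialDeriv i V₁ x := by
  unfold partialDeriv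
  rw [dirDeriv_add hV (contDiff_const.mul hV₁), dirDeriv_const_mul hV₁]

theorem abs_add_mul_le {a b d A B : ℝ} (ha : |a| ≤ A) (hb : |b| ≤ B) (hd : 0 ≤ d) (hd1 : d ≤ 1) :
    |a + d * b| ≤ A + B := by
  refine (abs_add_le _ _).trans (add_le_add ha ?_)
  rw [abs_mul, abs_of_nonneg hd]
  exact (mul_le_of_le_one_left (abs_nonneg b) hd1).trans hb

/-- A test profile that separates the datum `a₀` from the datum multiplied by the phase
`exp (-i κ V₁)`. -/
theorem exists_separating_profile (a₀ : 𝓢(EuclideanSpace ℝ (Fin n), ℂ))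
    {V₁ : EuclideanSpace ℝ (Fin n) → ℝ} (hV₁ : ContDiff ℝ ∞ V₁)
    (hsupp : ∃ x ∈ tsupport (a₀ : EuclideanSpace ℝ (Fin n) → ℂ), V₁ x ≠ 0) :
    ∃ κ : ℝ, 0 < κ ∧ ∃ χ : EuclideanSpace ℝ (Fin n) → ℂ, ContDiff ℝ ∞ χ ∧ HasCompactSupport χ ∧
      0 < ‖(∫ x, a₀ x * χ x) - ∫ x, a₀ x * modulated χ V₁ (-κ) x‖ := by
  obtain ⟨x₁, hx₁, hVx₁⟩ := hsupp
  -- The set where `V₁` is nonzero is open and meets the closure of the set where `a₀` is nonzero,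
  -- hence meets that set itself.
  obtain ⟨x₀, hVx₀, hax₀⟩ := mem_closure_iff.1 hx₁ {x | V₁ x ≠ 0}
    (isOpen_ne_fun hV₁.continuous continuous_const) hVx₁
  have ha : a₀ x₀ ≠ 0 := hax₀
  have hV0 : V₁ x₀ ≠ 0 := hVx₀
  -- This makes the phase `κ V₁ x₀` equal to `±1`, which is not a multiple of `2 π`; hence the
  -- exponential differs from `1` at `x₀`.
  set κ : ℝ := |V₁ x₀|⁻¹ with hκ
  have hκ0 : 0 < κ := inv_pos.2 (abs_pos.2 hV0)
  set ph : EuclideanSpace ℝ (Fin n) → ℂ :=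
    fun x => Complex.exp (Complex.I * ((-κ : ℝ) : ℂ) * V₁ x) with hph
  have hphs : ContDiff ℝ ∞ ph := (contDiff_phase hV₁ (-κ)).cexp
  have hph0 : ph x₀ ≠ 1 := by
    intro h1
    obtain ⟨m, hm⟩ := Complex.exp_eq_one_iff.1 h1
    have hre : -κ * V₁ x₀ = m * (2 * Real.pi) := by
      have := congrArg Complex.im hm
      simpa using this
    have habs : |-κ * V₁ x₀| = 1 := by
      rw [abs_mul, abs_neg, abs_of_pos hκ0, hκ, inv_mul_cancel₀ (abs_ne_zero.2 hV0)]
    rw [hre, abs_mul, abs_of_pos (by positivity : (0 : ℝ) < 2 * Real.pi)] at habs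
    have hpi := Real.pi_gt_three
    rcases eq_or_ne m 0 with h0 | h0
    · simp [h0] at habs
    · have : (1 : ℝ) ≤ |(m : ℝ)| := by exact_mod_cast Int.one_le_abs h0
      nlinarith
  set b : ContDiffBump x₀ := ⟨1, 2, one_pos, one_lt_two⟩ with hb
  set g : EuclideanSpace ℝ (Fin n) → ℂ := fun x => a₀ x * (1 - ph x) with hg
  have hgs : ContDiff ℝ ∞ g := a₀.smooth'.mul (contDiff_const.sub hphs)
  -- With the conjugate of `g` as profile, the difference of the two pairings becomes `∫ b ‖g‖ ^ 2`,
  -- positive because `g x₀ ≠ 0`.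
  set χ : EuclideanSpace ℝ (Fin n) → ℂ := fun x => (b x : ℂ) * (starRingEnd ℂ) (g x) with hχ
  have hχs : ContDiff ℝ ∞ χ :=
    (ContDiff.ofReal_infty b.contDiff).mul (Complex.conjCLE.contDiff.comp hgs)
  have hbc : HasCompactSupport fun x => (b x : ℂ) :=
    b.hasCompactSupport.comp_left (g := ((↑) : ℝ → ℂ)) (by simp)
  have hχc : HasCompactSupport χ := hbc.mul_right
  refine ⟨κ, hκ0, χ, hχs, hχc, ?_⟩
  have i1 : Integrable fun x => a₀ x * χ x :=
    (a₀.continuous.mul hχs.continuous).integrable_of_hasCompactSupport hχc.mul_left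
  have i2 : Integrable fun x => a₀ x * modulated χ V₁ (-κ) x :=
    (a₀.continuous.mul (contDiff_modulated hχs hV₁ (-κ)).continuous).integrable_of_hasCompactSupport
      (hasCompactSupport_modulated hχc (-κ)).mul_left
  rw [← integral_sub i1 i2]
  have hpt : ∀ x, a₀ x * χ x - a₀ x * modulated χ V₁ (-κ) x = ((b x * ‖g x‖ ^ 2 : ℝ) : ℂ) := by
    intro x
    have h1 : g x * (starRingEnd ℂ) (g x) = ((‖g x‖ ^ 2 : ℝ) : ℂ) := by
      rw [Complex.mul_conj, Complex.normSq_eq_norm_sq]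
    calc a₀ x * χ x - a₀ x * modulated χ V₁ (-κ) x
        = b x * (g x * (starRingEnd ℂ) (g x)) := by
          simp only [hχ, modulated, hg, hph]
          ring
      _ = _ := by rw [h1]; push_cast; rfl
  simp_rw [hpt]
  rw [integral_complex_ofReal, Complex.norm_real]
  refine norm_pos_iff.2 (ne_of_gt ?_)
  have hc : Continuous fun x => b x * ‖g x‖ ^ 2 := b.continuous.mul (hgs.continuous.norm.pow 2)
  refine hc.integral_pos_of_hasCompactSupport_nonneg_nonzero b.hasCompactSupport.mul_right
    (fun x => mul_nonneg b.nonneg (by positivity)) (x := x₀) ?_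
  have hb1 : b x₀ = 1 := b.one_of_mem_closedBall (by simp [hb])
  have hg0 : g x₀ ≠ 0 := mul_ne_zero ha (sub_ne_zero.2 hph0.symm)
  rw [hb1, one_mul]
  exact pow_ne_zero 2 (norm_ne_zero_iff.2 hg0)

/-- The error expands to `h t + 2 t ^ 2 + t ^ 3 / h`, and the last term is the cube of `t / h ^ (1 /
3)`: this is where the exponent `1 / 3` is decisive. -/
theorem tendsto_time_error {t : ℝ → ℝ}
    (ht : MuchSmaller t (fun h => h ^ (1 / 3 : ℝ))) :
    Tendsto t (𝓝[>] 0) (𝓝 0) ∧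
      Tendsto (fun h => h * t h * (1 + t h / h) ^ 2) (𝓝[>] 0) (𝓝 0) := by
  have hr : Tendsto (fun h => t h / h ^ (1 / 3 : ℝ)) (𝓝[>] 0) (𝓝 0) := ht
  have hid : Tendsto (fun h : ℝ => h) (𝓝[>] 0) (𝓝 0) := tendsto_id.mono_left nhdsWithin_le_nhds
  have hp : Tendsto (fun h : ℝ => h ^ (1 / 3 : ℝ)) (𝓝[>] 0) (𝓝 0) := by
    have := (Real.continuousAt_rpow_const 0 (1 / 3) (Or.inr (by norm_num))).tendsto
    rw [Real.zero_rpow (by norm_num)] at this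
    exact this.mono_left nhdsWithin_le_nhds
  have ht0 : Tendsto t (𝓝[>] 0) (𝓝 0) := by
    have h1 := hr.mul hp
    rw [mul_zero] at h1
    refine h1.congr' ?_
    filter_upwards [self_mem_nhdsWithin] with h hh
    exact div_mul_cancel₀ _ (Real.rpow_pos_of_pos hh _).ne'
  refine ⟨ht0, ?_⟩
  have h2 : Tendsto (fun h => h * t h + 2 * t h ^ 2 + (t h / h ^ (1 / 3 : ℝ)) ^ 3) (𝓝[>] 0)
      (𝓝 (0 * 0 + 2 * 0 ^ 2 + 0 ^ 3)) :=
    ((hid.mul ht0).add ((ht0.pow 2).const_mul 2)).add (hr.pow 3)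
  norm_num at h2
  refine Tendsto.congr' ?_ (by simpa using h2)
  filter_upwards [self_mem_nhdsWithin] with h hh
  have hh0 : (0 : ℝ) < h := hh
  have h3 : (h ^ (1 / 3 : ℝ)) ^ 3 = h := by
    rw [← Real.rpow_natCast, ← Real.rpow_mul hh0.le]
    norm_num
  have h4 : (t h / h ^ (3 : ℝ)⁻¹) ^ 3 = t h ^ 3 / h := by
    rw [div_pow, ← one_div, h3]
  rw [h4]
  field_simp
  ring

end Conclusion

/-! ### Instability at times of order `h / δ` -/

theorem propositionA1 (n : ℕ) (hn : 1 ≤ n)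
    (a₀ : 𝓢(EuclideanSpace ℝ (Fin n), ℂ))
    (V V₁ : EuclideanSpace ℝ (Fin n) → ℝ)
    (hV : IsSubquadraticPotential V) (hV₁ : IsSubquadraticPotential V₁)
    (hsupp : ∃ x ∈ tsupport (a₀ : EuclideanSpace ℝ (Fin n) → ℂ), V₁ x ≠ 0)
    (δ : ℝ → ℝ) (hδpos : ∀ h ∈ Ioc (0 : ℝ) 1, 0 < δ h)
    (hδlow : MuchSmaller (fun h => h ^ (2 / 3 : ℝ)) δ)
    (hδhigh : MuchSmaller δ (fun _ => 1))
    (u v : ℝ → ℝ → Lp ℂ 2 (volume : Measure (EuclideanSpace ℝ (Fin n))))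
    (hu : ∀ h ∈ Ioc (0 : ℝ) 1, IsSchrodingerSolution h V a₀ (u h))
    (hv : ∀ h ∈ Ioc (0 : ℝ) 1,
      IsSchrodingerSolution h (fun x => V x + δ h * V₁ x) a₀ (v h)) :
    ∃ t : ℝ → ℝ, (∀ h ∈ Ioc (0 : ℝ) 1, 0 < t h) ∧
      MuchSmaller t (fun h => h ^ (1 / 3 : ℝ)) ∧
      ∃ c : ℝ, 0 < c ∧ ∀ᶠ h in 𝓝[>] (0 : ℝ),
        ENNReal.ofReal c ≤ normLinftyL2 (t h) (fun s => u h s - v h s) := by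
  obtain ⟨κ, hκ, χ, hχ, hχc, hJ⟩ := exists_separating_profile a₀ hV₁.1 hsupp
  set J := ‖(∫ x, a₀ x * χ x) - ∫ x, a₀ x * modulated χ V₁ (-κ) x‖
  have hχ' := contDiff_modulated hχ hV₁.1 (-κ)
  have hχc' := hasCompactSupport_modulated (W := V₁) hχc (-κ)
  have htpos : ∀ h ∈ Ioc (0 : ℝ) 1, 0 < κ * h / δ h := fun h hh =>
    div_pos (mul_pos hκ hh.1) (hδpos h hh)
  have htsmall : MuchSmaller (fun h => κ * h / δ h) (fun h => h ^ (1 / 3 : ℝ)) := by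
    have h1 : Tendsto (fun h => κ * (h ^ (2 / 3 : ℝ) / δ h)) (𝓝[>] 0) (𝓝 (κ * 0)) :=
      Tendsto.const_mul κ hδlow
    rw [mul_zero] at h1
    refine h1.congr' ?_
    filter_upwards [self_mem_nhdsWithin] with h hh
    have hh0 : (0 : ℝ) < h := hh
    have h2 : h ^ (2 / 3 : ℝ) * h ^ (1 / 3 : ℝ) = h := by
      rw [← Real.rpow_add hh0]
      norm_num
    have h3 : h ^ (1 / 3 : ℝ) ≠ 0 := (Real.rpow_pos_of_pos hh0 _).ne'
    calc κ * (h ^ (2 / 3 : ℝ) / δ h)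
        = κ * (h ^ (2 / 3 : ℝ) * h ^ (1 / 3 : ℝ)) / δ h / h ^ (1 / 3 : ℝ) := by field_simp
      _ = _ := by rw [h2]
  obtain ⟨ht0, hterr⟩ := tendsto_time_error htsmall
  obtain ⟨A, hA, hVA⟩ := hV.exists_lipschitz
  obtain ⟨A₁, hA₁, hVA₁⟩ := hV₁.exists_lipschitz
  -- Since `δ h < 1` for small `h`, the sum `A + A₁` controls both `V` and the perturbed potential;
  -- the same reasoning gives `B + B₁` below.
  obtain ⟨K, T₀, hK, hT₀, hmass⟩ := exists_sup_norm_bound n (add_nonneg hA hA₁)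
  obtain ⟨B, hB, hVB⟩ := exists_bound_partialDeriv hχc.isCompact hV.1
  obtain ⟨B₁, hB₁, hVB₁⟩ := exists_bound_partialDeriv hχc.isCompact hV₁.1
  obtain ⟨C, hC, hpair⟩ := exists_pairing_modulated_le hχ hχc (add_nonneg hB hB₁)
  obtain ⟨C', hC', hpair'⟩ := exists_pairing_modulated_le hχ' hχc' (add_nonneg hB hB₁)
  have hχL : MemLp χ 2 volume := hχ.continuous.memLp_of_hasCompactSupport hχc
  set N := ‖MemLp.toLp χ hχL‖
  have hN : 0 ≤ N := norm_nonneg _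
  set m := K * ‖a₀.toLp 2 (volume : Measure (EuclideanSpace ℝ (Fin n)))‖
  refine ⟨fun h => κ * h / δ h, htpos, htsmall, J / (4 * (N + 1)), by positivity, ?_⟩
  have herr : ∀ᶠ h in 𝓝[>] (0 : ℝ),
      (C + C') * m * (h * (κ * h / δ h) * (1 + κ * h / δ h / h) ^ 2) < J / 2 := by
    have := hterr.const_mul ((C + C') * m)
    rw [mul_zero] at this
    exact this.eventually (gt_mem_nhds (by positivity))
  have hδ1 : ∀ᶠ h in 𝓝[>] (0 : ℝ), δ h / 1 < 1 := Tendsto.eventually_lt_const one_pos hδhigh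
  filter_upwards [herr, hδ1, ht0.eventually (gt_mem_nhds hT₀), Ioc_mem_nhdsGT one_pos]
    with h herr hδ1 htT hh
  rw [div_one] at hδ1
  have hδ0 := hδpos h hh
  have hT := htpos h hh
  set T := κ * h / δ h with hTdef
  have hvW : ContDiff ℝ ∞ fun x => V x + δ h * V₁ x := hV.1.add (contDiff_const.mul hV₁.1)
  have hucont := (hu h hh).continuousOn
  have hvcont := (hv h hh).continuousOn
  refine ofReal_le_normLinftyL2 (hucont.sub hvcont) hT ?_
  have hu0 : (u h) 0 = a₀.toLp 2 volume := (hu h hh).initial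
  have hv0 : (v h) 0 = a₀.toLp 2 volume := (hv h hh).initial
  have huM : ∀ s ∈ Icc 0 T, ‖u h s‖ ≤ m := fun s hs => by
    have := hmass h hh V hV.1 (fun x y => (hVA x y).trans (by gcongr; linarith)) a₀ (u h) (hu h hh)
      s ⟨hs.1, hs.2.trans htT.le⟩
    rwa [hu0] at this
  have hvM : ∀ s ∈ Icc 0 T, ‖v h s‖ ≤ m := fun s hs => by
    have := hmass h hh _ hvW (fun x y => by
      have e : V x + δ h * V₁ x - (V y + δ h * V₁ y) = (V x - V y) + δ h * (V₁ x - V₁ y) := by ring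
      rw [e]
      refine (abs_add_mul_le (hVA x y) (hVA₁ x y) hδ0.le hδ1.le).trans (le_of_eq (by ring)))
      a₀ (v h) (hv h hh) s ⟨hs.1, hs.2.trans htT.le⟩
    rwa [hv0] at this
  have hpu := hpair h hh.1 V hV.1
    (fun x hx i => ⟨(hVB x hx i).1.trans (by linarith), (hVB x hx i).2.trans (by linarith)⟩)
    a₀ (u h) (hu h hh) T m hT.le huM
  have hpv := hpair' h hh.1 _ hvW
    (fun x hx i => by
      have hx' := tsupport_modulated_subset _ hx
      rw [partialDeriv_add_const_mul hV.1 hV₁.1, partialDeriv_add_const_mul (hV.1.partialDeriv i)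
        (hV₁.1.partialDeriv i)]
      exact ⟨abs_add_mul_le (hVB x hx' i).1 (hVB₁ x hx' i).1 hδ0.le hδ1.le,
        abs_add_mul_le (hVB x hx' i).2 (hVB₁ x hx' i).2 hδ0.le hδ1.le⟩)
    a₀ (v h) (hv h hh) T m hT.le hvM
  have hinit : ∀ φ : EuclideanSpace ℝ (Fin n) → ℂ,
      ∫ x, (a₀.toLp 2 (volume : Measure (EuclideanSpace ℝ (Fin n)))) x * φ x =
        ∫ x, a₀ x * φ x := fun φ => by
    refine integral_congr_ae ?_
    filter_upwards [a₀.coeFn_toLp 2 volume] with x hx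
    rw [hx]
  -- Because `T * δ h / h = κ`, the initial twist by `-κ V₁` is undone exactly at time `T`, and `u`
  -- and `v` are tested against the same function.
  have hphase : ∀ x, modulated (modulated χ V₁ (-κ)) (fun x => V x + δ h * V₁ x) (T / h) x =
      modulated χ V (T / h) x := by
    intro x
    have hκT : T / h * δ h = κ := by
      rw [hTdef]
      field_simp [hh.1.ne', hδ0.ne']
    unfold modulated
    rw [mul_assoc, ← Complex.exp_add]
    congr 2
    rw [← hκT]
    push_cast
    ring
  simp_rw [hphase] at hpv
  rw [hu0, hinit] at hpu
  rw [hv0, hinit] at hpv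
  have hmod := memLp_modulated hχ hχc hV.1 (T / h)
  have hdiff : ∫ x, (u h T - v h T) x * modulated χ V (T / h) x =
      (∫ x, u h T x * modulated χ V (T / h) x) - ∫ x, v h T x * modulated χ V (T / h) x := by
    rw [← integral_sub (integrable_mul_of_memLp_two _ hmod) (integrable_mul_of_memLp_two _ hmod)]
    refine integral_congr_ae ?_
    filter_upwards [Lp.coeFn_sub (u h T) (v h T)] with x hx
    rw [hx, Pi.sub_apply, sub_mul]
  have hcs := norm_integral_mul_le (u h T - v h T) hmod
  have hmodN : ‖MemLp.toLp _ hmod‖ ≤ N := by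
    have := norm_toLp_le_of_norm_le hmod hχL zero_le_one
      (fun x => by rw [one_mul, norm_modulated])
    rwa [one_mul] at this
  rw [hdiff] at hcs
  set X := ∫ x, u h T x * modulated χ V (T / h) x
  set Y := ∫ x, v h T x * modulated χ V (T / h) x
  set P := ∫ x, a₀ x * χ x
  set P' := ∫ x, a₀ x * modulated χ V₁ (-κ) x
  have htri : J ≤ ‖X - P‖ + ‖Y - P'‖ + ‖X - Y‖ := by
    calc J = ‖(X - Y) - (X - P) + (Y - P')‖ := by
          change ‖P - P'‖ = _
          congr 1
          ring
      _ ≤ ‖X - Y‖ + ‖X - P‖ + ‖Y - P'‖ := (norm_add_le _ _).trans (by gcongr; exact norm_sub_le _ _)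
      _ = _ := by ring
  -- The two pairing errors together are below `J / 2`, so at least half of the separation `J`
  -- survives. The factor `N + 1` in the final constant avoids dividing by `N`.
  have hXY : J / 2 < N * ‖u h T - v h T‖ := by
    have h1 : ‖X - Y‖ ≤ N * ‖u h T - v h T‖ := hcs.trans (by gcongr)
    linarith
  have hpos : 0 < N * ‖u h T - v h T‖ := lt_of_le_of_lt (by positivity) hXY
  rw [div_lt_iff₀ (by positivity)]
  change J < ‖u h T - v h T‖ * (4 * (N + 1))
  nlinarith [norm_nonneg (u h T - v h T)]
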